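/- **Setting.** Let $S^1$ be the set $[0,\infty)$ with the circle topology obtained from $[0,\infty]$ by identifying $\infty$ with $0$, with the multiplication of $[0,\infty)$ and the convention $0^\alpha=0$ for every $\alpha\in\mathbb R$. A marked partition is a pair $x=(\pi,\mathbf v)$ of a partition $\pi$ of $\mathbb N=\{1,2,\dots\}$ and a sequence $\mathbf v\in (S^1)^{\mathbb N}$ that is constant on the blocks of $\pi$; the space $\mathcal M_\infty$ of marked partitions has the product topology (the relations $i\sim^\pi j$ being discrete-valued). Blocks are labelled $1,2,\dots$ by increasing least element, $(\mathbf 1,1)$ is the marked partition with a single block, of mark $1$, and for a permutation $\sigma$ of $\mathbb N$ with finite support, $x^\sigma$ is given by $i\sim^{x^\sigma}j\iff\sigma(i)\sim^x\sigma(j)$ and marks $v_{\sigma(i)}$. For paths $\bar x^{(k)}=(\bar\pi^{(k)},\bar{\mathbf v}^{(k)}):[0,\infty)\to\mathcal M_\infty$, $k\ge1$, define $\mathrm{ssfrag}_\alpha(x,\bar x^{(\cdot)})(t)=(\hat\pi(t),\hat{\mathbf v}(t))$ by $$\hat v_i(t)=v_i\,\bar v^{(k_i)}_i(v_i^\alpha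 t),\qquad i\sim^{\hat\pi(t)}j\iff i\sim^\pi j\ \text{ and }\ i\sim j \text{ in }\bar\pi^{(k_i)}(v_i^\alpha t),$$ where $k_i$ is the label of the block of $\pi$ containing $i$. An $\alpha$-ESSF (extended self-similar fragmentation of index $\alpha\in\mathbb R$) is an $\mathcal M_\infty$-valued process $X=(\Pi,\mathbf V)$ with càdlàg paths, with laws $(\mathbb P_x)_{x\in\mathcal M_\infty}$ depending measurably on $x$, where $X(0)=x$ $\mathbb P_x$-a.s., which is stochastically continuous and strong Markov, and such that for all $x$: (i) $X^\sigma$ under $\mathbb P_x$ has the law of $X$ under $\mathbb P_{x^\sigma}$ for every permutation $\sigma$ with finite support; (ii) $X$ under $\mathbb P_x$ has the law of $\mathrm{ssfrag}_\alpha(x,X^{(\cdot)})$, where $X^{(\cdot)}=(X^{(k)})_{k\ge1}$ is an i.i.d. sequence of copies of the process started from $(\mathbf 1,1)$. Let $B_i(t)$ be the block of $\Pi(t)$ containing $i$, and $\mathcal G_i(t)=\sigma(B_i(s),V_i(s),\,s\le t)$. A stopping line is a sequence $L=(L_i)_{i\ge1}$ of $[0,\infty]$-valued random variables such that each $L_i$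 is a $(\mathcal G_i(t))_{t\ge0}$-stopping time and, almost surely, $i\sim^{\Pi(L_i)}j$ implies $L_i=L_j$ for all $i,j$. Here $\Pi(\infty)=\lim_{t\to\infty}\Pi(t)$, and $V_i(\infty)=0$. Let $X(L)$ be the marked partition with $i\sim j\iff i\sim^{\Pi(L_i)}j$ and marks $V_i(L_i)$; the sequences $(L_i+t)_i$ and $(L_i\wedge t)_i$ are again stopping lines and define $X(L+t)$ and $X(L\wedge t)$, $t\ge0$. Let $\mathcal G_L=\sigma(X(L\wedge t),\,t\ge0)$. **Proposition (Markov property along stopping lines).** Let $X$ be an $\alpha$-ESSF, started from an arbitrary initial law, and let $L$ be a stopping line. Then, conditionally on $\mathcal G_L$, $$\big(X(L+t)\big)_{t\ge0}\ \overset{(d)}{=}\ \mathrm{ssfrag}_\alpha\big(X(L),X^{(\cdot)}\big),$$ where $X^{(\cdot)}$ is an i.i.d. sequence of copies of the process started from $(\mathbf 1,1)$, independent of $X$. That is, for every measurable set $C$ of paths, the conditional probabilities given $\mathcal G_L$ that either side belongs to $C$ are almost surely equal. -/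

import Mathlib

open MeasureTheory ProbabilityTheory Filter Topology Set
open scoped NNReal ENNReal

/-- The topology of the circle `S¹` on `[0, ∞)`: the quotient topology of `[0, ∞]` obtained by
identifying `∞` with `0`. A set is open iff it is open in `[0, ∞)` in the usual sense and, if it
contains `0`, also contains a half-line `(A, ∞)`. -/
@[reducible]
def circleTopology : TopologicalSpace ℝ≥0 :=
  TopologicalSpace.coinduced ENNReal.toNNReal inferInstance

/-- Marked partitions of the set of positive integers, the integer `i + 1` being represented by
`i : ℕ`: an equivalence relation with a family of marks that is constant on its blocks. Marks are
points of `S¹`, represented by elements of `[0, ∞)`. -/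
@[ext]
structure MarkedPartition where
  rel : Setoid ℕ
  mark : ℕ → ℝ≥0
  mark_eq : ∀ i j, rel.r i j → mark i = mark j

namespace MarkedPartition

/-- The topology inherited from the product topology; each relation `i ∼ j` takes values in the
discrete space `Prop`, and each mark takes values in the circle. -/
instance instTopologicalSpace : TopologicalSpace MarkedPartition :=
  (⨅ i : ℕ, ⨅ j : ℕ,
      TopologicalSpace.induced (fun x : MarkedPartition => x.rel.r i j) (⊥ : TopologicalSpace Prop)) ⊓
    ⨅ i : ℕ, TopologicalSpace.induced (fun x : MarkedPartition => x.mark i) circleTopology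

/-- The Borel `σ`-algebra of marked partitions. -/
instance instMeasurableSpace : MeasurableSpace MarkedPartition := borel MarkedPartition

instance instBorelSpace : BorelSpace MarkedPartition := ⟨rfl⟩

/-- The marked partition `(𝟏, 1)` with a single block, of mark `1`. -/
def one : MarkedPartition where
  rel := ⊤
  mark _ := 1
  mark_eq _ _ _ := rfl

/-- The action `x ↦ x^σ` of a permutation. -/
def perm (σ : Equiv.Perm ℕ) (x : MarkedPartition) : MarkedPartition where
  rel := x.rel.comap σ
  mark i := x.mark (σ i)
  mark_eq i j h := x.mark_eq (σ i) (σ j) h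

/-- The block containing `i`. -/
def block (x : MarkedPartition) (i : ℕ) : Set ℕ := {j | x.rel.r i j}

/-- The least element of the block containing `i`. -/
noncomputable def blockMin (x : MarkedPartition) (i : ℕ) : ℕ := sInf (x.block i)

/-- The label of the block containing `i` when the blocks are listed by increasing least element,
labels starting from `0`: the number of blocks whose least element is smaller. -/
noncomputable def label (x : MarkedPartition) (i : ℕ) : ℕ :=
  ((Finset.range (x.blockMin i)).filter fun j => x.blockMin j = j).card

lemma measurable_rel (i j : ℕ) : Measurable fun x : MarkedPartition => x.rel.r i j := by
  have h : instTopologicalSpace ≤ TopologicalSpace.induced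
      (fun x : MarkedPartition => x.rel.r i j) (⊥ : TopologicalSpace Prop) :=
    inf_le_left.trans ((iInf_le _ i).trans (iInf_le _ j))
  intro s _
  have ho : IsOpen ((fun x : MarkedPartition => x.rel.r i j) ⁻¹' s) := h _ ⟨s, trivial, rfl⟩
  exact ho.measurableSet

lemma measurable_block (i : ℕ) : Measurable fun x : MarkedPartition => x.block i :=
  measurable_set_iff.2 fun j => measurable_rel i j

lemma measurable_mark (i : ℕ) : Measurable fun x : MarkedPartition => x.mark i := by
  have h : instTopologicalSpace ≤ TopologicalSpace.induced
      (fun x : MarkedPartition => x.mark i) circleTopology :=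
    inf_le_right.trans (iInf_le _ i)
  have key : ∀ u : Set ℝ≥0, IsOpen u → (0 : ℝ≥0) ∉ u → IsOpen[circleTopology] u := by
    intro u hu h0
    rw [isOpen_coinduced]
    have : ENNReal.toNNReal ⁻¹' u = ENNReal.ofNNReal '' u := by
      ext a
      induction a <;> simp [h0]
    rw [this]
    exact ENNReal.isOpenEmbedding_coe.isOpenMap u hu
  have key' : ∀ u : Set ℝ≥0, IsOpen u → (0 : ℝ≥0) ∉ u →
      MeasurableSet ((fun x : MarkedPartition => x.mark i) ⁻¹' u) := by
    intro u hu h0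
    have ho : IsOpen ((fun x : MarkedPartition => x.mark i) ⁻¹' u) :=
      h _ ⟨u, key u hu h0, rfl⟩
    exact ho.measurableSet
  refine measurable_of_isOpen fun u hu => ?_
  by_cases h0 : (0 : ℝ≥0) ∈ u
  · have hc := (key' {0}ᶜ isOpen_compl_singleton (by simp)).compl
    have ho := key' (u \ {0}) (hu.sdiff isClosed_singleton) (by simp)
    convert hc.union ho using 1
    ext x
    by_cases hx : x.mark i = 0 <;> simp [hx, h0]
  · exact key' u hu h0

lemma label_eq (x : MarkedPartition) {i j : ℕ} (h : x.rel.r i j) : x.label i = x.label j := by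
  have hb : x.block i = x.block j := by
    ext k
    exact ⟨fun hk => x.rel.trans' (x.rel.symm' h) hk, fun hk => x.rel.trans' h hk⟩
  have hm : x.blockMin i = x.blockMin j := by rw [blockMin, blockMin, hb]
  rw [label, label, hm]

end MarkedPartition

open MarkedPartition

/-- The power `v ^ α` with the convention `0 ^ α = 0` for every real `α`, including `α = 0`. -/
noncomputable def markPow (v : ℝ≥0) (α : ℝ) : ℝ≥0 := if v = 0 then 0 else v ^ α

/-- The self-similar fragmentation operator: the block of `x` with label `k` and mark `v` fragments
according to the path `t ↦ y k (v ^ α * t)`, with marks multiplied by `v`. -/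
noncomputable def ssfrag (α : ℝ) (x : MarkedPartition) (y : ℕ → ℝ≥0 → MarkedPartition) (t : ℝ≥0) :
    MarkedPartition where
  rel :=
    { r := fun i j => x.rel.r i j ∧ (y (x.label i) (markPow (x.mark i) α * t)).rel.r i j
      iseqv := by
        refine ⟨fun i => ⟨x.rel.refl' i, Setoid.refl' _ i⟩, ?_, ?_⟩
        · rintro i j ⟨h, h'⟩
          rw [x.label_eq h, x.mark_eq i j h] at h'
          exact ⟨x.rel.symm' h, Setoid.symm' _ h'⟩
        · rintro i j k ⟨h, h'⟩ ⟨g, g'⟩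
          rw [← x.label_eq h, ← x.mark_eq i j h] at g'
          exact ⟨x.rel.trans' h g, Setoid.trans' _ h' g'⟩ }
  mark i := x.mark i * (y (x.label i) (markPow (x.mark i) α * t)).mark i
  mark_eq := by
    rintro i j ⟨h, h'⟩
    rw [x.label_eq h, x.mark_eq i j h] at h' ⊢
    rw [MarkedPartition.mark_eq _ i j h']

/-- A path is càdlàg if it is right-continuous with left limits. -/
def IsCadlag (x : ℝ≥0 → MarkedPartition) : Prop :=
  ∀ t, ContinuousWithinAt x (Ici t) t ∧ ∃ l, Tendsto x (𝓝[<] t) (𝓝 l)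

section Fragmentation

variable {Ω : Type*} [MeasurableSpace Ω]

/-- The natural filtration `σ(X s, s ≤ t)` of a process. -/
def naturalFiltration (X : ℝ≥0 → Ω → MarkedPartition) (hX : ∀ t, Measurable (X t)) :
    Filtration ℝ≥0 (inferInstance : MeasurableSpace Ω) where
  seq t := ⨆ s : ℝ≥0, ⨆ _ : s ≤ t, MeasurableSpace.comap (X s) inferInstance
  mono' _ _ h := iSup_mono fun _ => iSup_mono' fun hs => ⟨hs.trans h, le_rfl⟩
  le' _ := iSup₂_le fun s _ => (hX s).comap_le

/-- The process `X` under `(P x)_x` is an extended self-similar fragmentation with index `α`. The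
measure `P x` is the law under which `X` is started from `x`. Laws of processes are considered on
the space of all paths with the product `σ`-algebra. -/
structure IsESSF (α : ℝ) (X : ℝ≥0 → Ω → MarkedPartition) (P : Kernel MarkedPartition Ω)
    [IsMarkovKernel P] : Prop where
  measurable : ∀ t, Measurable (X t)
  cadlag : ∀ ω, IsCadlag fun t => X t ω
  start : ∀ x, ∀ᵐ ω ∂P x, X 0 ω = x
  /-- For every `t`, `X s` converges to `X t` in probability as `s → t`; convergence is expressed
  with the neighbourhoods of the diagonal, that is, with the uniform structure of the compact
  space of marked partitions. -/
  stochastically_continuous : ∀ x t, ∀ U : Set (MarkedPartition × MarkedPartition), IsOpen U →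
    (∀ y, (y, y) ∈ U) → Tendsto (fun s => P x {ω | (X s ω, X t ω) ∉ U}) (𝓝 t) (𝓝 0)
  /-- The strong Markov property: for a stopping time `τ` of the natural filtration, on `τ < ∞` and
  conditionally on the past up to `τ`, the process `X (τ + ·)` has the law of `X` under
  `P (X τ)`. -/
  strong_markov : ∀ x, ∀ τ : Ω → ℝ≥0∞, ∀ hτ : IsStoppingTime (naturalFiltration X measurable) τ,
    ∀ A : Set Ω, MeasurableSet[hτ.measurableSpace] A →
    ∀ C : Set (ℝ≥0 → MarkedPartition), MeasurableSet C →
      P x (A ∩ {ω | τ ω < ∞ ∧ (fun t => X ((τ ω).toNNReal + t) ω) ∈ C}) =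
        ∫⁻ ω in A ∩ {ω | τ ω < ∞}, P (X (τ ω).toNNReal ω) {ω' | (fun t => X t ω') ∈ C} ∂P x
  exchangeable : ∀ σ : Equiv.Perm ℕ, {n | σ n ≠ n}.Finite → ∀ x,
    (P x).map (fun ω t => (X t ω).perm σ) = (P (x.perm σ)).map (fun ω t => X t ω)
  /-- Self-similar branching; under the product measure `⨂ₖ P (𝟏, 1)` on `ℕ → Ω`, the processes
  `t ↦ X t (ω k)` are i.i.d. copies of `X` started from `(𝟏, 1)`. -/
  branching : ∀ x, (P x).map (fun ω t => X t ω) =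
    (Measure.infinitePi fun _ : ℕ => P one).map
      (fun ω => ssfrag α x fun k t => X t (ω k))

/-- The filtration `𝒢ᵢ(t) = σ(Bᵢ s, Vᵢ s, s ≤ t)`, where `Bᵢ s` is the block of `X s` containing
`i` and `Vᵢ s` is its mark. -/
def blockFiltration (X : ℝ≥0 → Ω → MarkedPartition) (hX : ∀ t, Measurable (X t)) (i : ℕ) :
    Filtration ℝ≥0 (inferInstance : MeasurableSpace Ω) where
  seq t := ⨆ s : ℝ≥0, ⨆ _ : s ≤ t,
    MeasurableSpace.comap (fun ω => (X s ω).block i) inferInstance ⊔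
      MeasurableSpace.comap (fun ω => (X s ω).mark i) inferInstance
  mono' _ _ h := iSup_mono fun _ => iSup_mono' fun hs => ⟨hs.trans h, le_rfl⟩
  le' _ := iSup₂_le fun s _ => sup_le ((measurable_block i).comp (hX s)).comap_le
    ((measurable_mark i).comp (hX s)).comap_le

/-- The value at infinity of a path `(π, v)`: all marks are `0`, and two integers are equivalent if
they are equivalent at all large times. When `π t` becomes finer as `t` increases, this is
`(lim π t, 0)`. -/
def atInfinity (x : ℝ≥0 → MarkedPartition) : MarkedPartition where
  rel :=
    { r := fun i j => ∀ᶠ t in atTop, (x t).rel.r i j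
      iseqv := by
        refine ⟨fun i => Eventually.of_forall fun t => (x t).rel.refl' i, ?_, ?_⟩
        · intro i j h
          exact h.mono fun t ht => (x t).rel.symm' ht
        · intro i j k h g
          exact (h.and g).mono fun t ht => (x t).rel.trans' ht.1 ht.2 }
  mark _ := 0
  mark_eq _ _ _ := rfl

/-- The value of a path at a time in `[0, ∞]`. -/
noncomputable def atTime (x : ℝ≥0 → MarkedPartition) (s : ℝ≥0∞) : MarkedPartition :=
  if s = ∞ then atInfinity x else x s.toNNReal

/-- The value of a path `x = (π, v)` along a line `l`: the block and the mark of `i` are read at time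
`l i`. If `i ∼ j` in `π (l i)` implies `l i = l j`, then the clause `l i = l j` is redundant and
`i ∼ j` holds iff it holds in `π (l i)`. The clause makes the definition meaningful for all `l`. -/
noncomputable def alongLine (x : ℝ≥0 → MarkedPartition) (l : ℕ → ℝ≥0∞) : MarkedPartition where
  rel :=
    { r := fun i j => l i = l j ∧ (atTime x (l i)).rel.r i j
      iseqv := by
        refine ⟨fun i => ⟨rfl, Setoid.refl' _ i⟩, ?_, ?_⟩
        · rintro i j ⟨h, h'⟩
          exact ⟨h.symm, h ▸ Setoid.symm' _ h'⟩
        · rintro i j k ⟨h, h'⟩ ⟨g, g'⟩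
          rw [← h] at g'
          exact ⟨h.trans g, Setoid.trans' _ h' g'⟩ }
  mark i := (atTime x (l i)).mark i
  mark_eq := by
    rintro i j ⟨h, h'⟩
    rw [← h]
    exact MarkedPartition.mark_eq _ i j h'

/-- A stopping line of the process `X` under the probability measure `Q`. -/
structure IsStoppingLine (X : ℝ≥0 → Ω → MarkedPartition) (hX : ∀ t, Measurable (X t))
    (Q : Measure Ω) (L : ℕ → Ω → ℝ≥0∞) : Prop where
  isStoppingTime : ∀ i, IsStoppingTime (blockFiltration X hX i) (L i)
  eq_of_rel : ∀ᵐ ω ∂Q, ∀ i j,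
    (atTime (fun t => X t ω) (L i ω)).rel.r i j → L i ω = L j ω

/-- The random marked partition `X(L)`. -/
noncomputable def stoppedValueAt (X : ℝ≥0 → Ω → MarkedPartition) (L : ℕ → Ω → ℝ≥0∞) (ω : Ω) :
    MarkedPartition :=
  alongLine (fun t => X t ω) fun i => L i ω

/-- The `σ`-algebra `𝒢_L = σ(X(L ∧ t), t ≥ 0)`. -/
@[reducible]
noncomputable def lineSigma (X : ℝ≥0 → Ω → MarkedPartition) (L : ℕ → Ω → ℝ≥0∞) : MeasurableSpace Ω :=
  ⨆ t : ℝ≥0, MeasurableSpace.comap (stoppedValueAt X fun i ω => min (L i ω) t) inferInstance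

end Fragmentation

/-! By the branching property, the path of a block is a function of the block, its mark and one of
the i.i.d. copies. Hence distinct blocks evolve independently, and the law of the evolution of some
blocks depends on the initial state only through these blocks and their marks
(`IsESSF.prob_blockPath` and its consequences).

Let finitely many integers be stopped along a deterministic line, on the event that integers with
different stopping times are already separated at the earlier one. The values of the line are peeled
off in increasing order. At the smallest value, the blocks to be restarted differ from those still
running, so the simple Markov property replaces the future of the former by its conditional
probability without touching the latter (`IsESSF.lintegral_line_cylinder`, `IsESSF.prob_line`). A
stopping line with countably many values is handled by summing over its values on a finite set of
integers; blocks that are never stopped have mark `0` and are frozen on both sides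
(`IsESSF.prob_discreteLine_cylinder`, `IsESSF.map_lineCoord_of_discrete`).

A general line `L` is rounded up to the grid of mesh `1 / (n + 1)`. The stopped and restarted paths
converge by right continuity. For the independent copies attached to `X(L)` there are two obstacles.
A copy might jump at the time at which it is read; since copies are independent of `X` and
stochastically continuous, this almost surely does not happen. And `v ↦ v ^ α` is discontinuous at
`0` on the circle; but by the strong Markov property at `L i` a block whose mark is `0` there is
frozen afterwards, so the approximating marks are `0` too. Equality of joint laws therefore passes
to the limit (`IsESSF.map_lineCoord`), and the joint law of the stopped and the restarted path
determines the conditional probabilities.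

Topology and measurability are reduced to countably many real coordinates, the circle being embedded
in the plane. -/

/-! ### Real coordinates of marked partitions -/

/-- With `circleSnd`, an embedding of the circle `S¹` into the plane. -/
noncomputable def circleFst (v : ℝ≥0) : ℝ := v / (1 + v ^ 3)

/-- With `circleFst`, an embedding of the circle `S¹` into the plane. -/
noncomputable def circleSnd (v : ℝ≥0) : ℝ := v ^ 2 / (1 + v ^ 3)

lemma circleFst_zero : circleFst 0 = 0 := by simp [circleFst]

lemma circleSnd_zero : circleSnd 0 = 0 := by simp [circleSnd]

lemma circleFst_pos {v : ℝ≥0} (hv : v ≠ 0) : 0 < circleFst v := by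
  have : (0 : ℝ) < v := by exact_mod_cast pos_iff_ne_zero.2 hv
  unfold circleFst; positivity

lemma circleFst_nonneg (v : ℝ≥0) : 0 ≤ circleFst v := by
  unfold circleFst; positivity

lemma circleSnd_nonneg (v : ℝ≥0) : 0 ≤ circleSnd v := by
  unfold circleSnd; positivity

/-- The two coordinates trace the loop of the folium `x ^ 3 + y ^ 3 = x * y`, on which the mark is
the slope. At the node, `0 / 0 = 0` still returns the mark. -/
lemma circleSnd_div_circleFst (v : ℝ≥0) : circleSnd v / circleFst v = v := by
  by_cases hv : v = 0
  · simp [hv, circleSnd, circleFst]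
  · have h : (v : ℝ) ≠ 0 := by exact_mod_cast hv
    have h' : (1 + (v : ℝ) ^ 3) ≠ 0 := by positivity
    unfold circleSnd circleFst
    field_simp

lemma continuous_circleFst : Continuous circleFst := by
  unfold circleFst
  refine Continuous.div (by fun_prop) (by fun_prop) fun v => by positivity

lemma continuous_circleSnd : Continuous circleSnd := by
  unfold circleSnd
  refine Continuous.div (by fun_prop) (by fun_prop) fun v => by positivity

lemma circleFst_le (v : ℝ≥0) : circleFst v ≤ 2 * (v : ℝ)⁻¹ := by
  by_cases hv : v = 0
  · simp [hv, circleFst]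
  have h : (0 : ℝ) < v := by exact_mod_cast pos_iff_ne_zero.2 hv
  unfold circleFst
  rw [div_le_iff₀ (by positivity), ← mul_inv_cancel_left₀ h.ne' (2 * _ * _)]
  have : (v : ℝ) * (2 * (v : ℝ)⁻¹ * (1 + (v : ℝ) ^ 3)) = 2 * (1 + (v : ℝ) ^ 3) := by
    field_simp
  rw [← sub_nonneg]
  have e : (v : ℝ) * ((v : ℝ)⁻¹ * (2 * (v : ℝ)⁻¹ * (1 + (v : ℝ) ^ 3))) - v
      = (2 + 2 * (v : ℝ) ^ 3 - (v : ℝ) ^ 2) / v := by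
    field_simp
  rw [e]
  have : 0 ≤ 2 + 2 * (v : ℝ) ^ 3 - (v : ℝ) ^ 2 := by
    rcases le_total (v : ℝ) 1 with h1 | h1
    · nlinarith [pow_pos h 3]
    · nlinarith [pow_pos h 2]
  positivity

lemma circleSnd_le (v : ℝ≥0) : circleSnd v ≤ (v : ℝ)⁻¹ := by
  by_cases hv : v = 0
  · simp [hv, circleSnd]
  have h : (0 : ℝ) < v := by exact_mod_cast pos_iff_ne_zero.2 hv
  unfold circleSnd
  rw [div_le_iff₀ (by positivity), inv_mul_eq_div, le_div_iff₀ h]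
  nlinarith

/-- Inverting zero in `ℝ` fits the identification of `∞` with `0`: at `∞` the expression is `0⁻¹ =
0`, which is also its limit. -/
lemma tendsto_coe_toNNReal_inv_top :
    Tendsto (fun a : ℝ≥0∞ => ((a.toNNReal : ℝ≥0) : ℝ)⁻¹) (𝓝 ∞) (𝓝 0) := by
  have h : Tendsto (fun a : ℝ≥0∞ => (a⁻¹).toReal) (𝓝 ∞) (𝓝 0) := by
    have h1 : Tendsto (fun a : ℝ≥0∞ => a⁻¹) (𝓝 ∞) (𝓝 0) := by
      simpa using (tendsto_inv_iff.2 (tendsto_id (x := 𝓝 ∞)) : Tendsto (fun a : ℝ≥0∞ => a⁻¹) _ _)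
    exact (ENNReal.tendsto_toReal ENNReal.zero_ne_top).comp h1
  refine h.congr fun a => ?_
  rw [ENNReal.toReal_inv]; rfl

/-- Continuity on the quotient is continuity on `[0, ∞]` after composition with `ENNReal.toNNReal`.
The only new point is `∞`, where the bound forces the limit `0 = f 0`. -/
lemma continuous_circle_of_bound {f : ℝ≥0 → ℝ} (hf : Continuous f) (h0 : f 0 = 0)
    (hn : ∀ v, 0 ≤ f v) {c : ℝ} (hb : ∀ v, f v ≤ c * (v : ℝ)⁻¹) :
    Continuous[circleTopology, inferInstance] f := by
  rw [continuous_coinduced_dom, continuous_iff_continuousAt]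
  intro a
  by_cases ha : a = ∞
  · subst ha
    have h1 : Tendsto (fun a : ℝ≥0∞ => c * ((a.toNNReal : ℝ≥0) : ℝ)⁻¹) (𝓝 ∞) (𝓝 0) := by
      simpa using tendsto_coe_toNNReal_inv_top.const_mul c
    have h2 : (f ∘ ENNReal.toNNReal) ∞ = 0 := by simp [h0]
    rw [ContinuousAt, h2]
    exact tendsto_of_tendsto_of_tendsto_of_le_of_le tendsto_const_nhds h1 (fun a => hn _)
      (fun a => hb _)
  · exact hf.continuousAt.comp (ENNReal.tendsto_toNNReal ha)

lemma continuous_circle_circleFst : Continuous[circleTopology, inferInstance] circleFst :=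
  continuous_circle_of_bound continuous_circleFst circleFst_zero circleFst_nonneg circleFst_le

lemma continuous_circle_circleSnd : Continuous[circleTopology, inferInstance] circleSnd :=
  continuous_circle_of_bound (c := 1) continuous_circleSnd circleSnd_zero circleSnd_nonneg
    (by simpa using circleSnd_le)

/-- A continuous injection of a compact space into a Hausdorff space is a closed embedding, and the
circle is compact as an image of `[0, ∞]`. -/
lemma circleTopology_eq_induced : circleTopology =
    TopologicalSpace.induced (fun v => (circleFst v, circleSnd v)) inferInstance := by
  have hc : @CompactSpace ℝ≥0 circleTopology := by
    let := circleTopology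
    refine ⟨?_⟩
    have h : Continuous[inferInstance, circleTopology] ENNReal.toNNReal := continuous_coinduced_rng
    have := isCompact_univ.image h
    have hs : Function.Surjective ENNReal.toNNReal := fun v => ⟨v, by simp⟩
    rwa [image_univ, hs.range_eq] at this
  have hcont : Continuous[circleTopology, inferInstance]
      (fun v => (circleFst v, circleSnd v)) := by
    let := circleTopology
    exact continuous_circle_circleFst.prodMk continuous_circle_circleSnd
  have hinj : Function.Injective (fun v : ℝ≥0 => (circleFst v, circleSnd v)) := by
    intro v w h
    simp only [Prod.mk.injEq] at h
    have := circleSnd_div_circleFst v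
    rw [h.1, h.2, circleSnd_div_circleFst] at this
    exact_mod_cast this.symm
  let := circleTopology
  exact (Continuous.isClosedEmbedding hcont hinj).isInducing.eq_induced

/-! ### Coordinates of marked partitions and the topology and `σ`-algebra they generate. -/

namespace MarkedPartition

/-- The index set of the real coordinates of a marked partition: relations and two coordinates for
each mark. -/
abbrev Coord := (ℕ × ℕ) ⊕ (ℕ ⊕ ℕ)

open Classical in
/-- Real coordinates of a marked partition. -/
noncomputable def coord : Coord → MarkedPartition → ℝ
  | .inl p, x => if x.rel.r p.1 p.2 then 1 else 0
  | .inr (.inl i), x => circleFst (x.mark i)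
  | .inr (.inr i), x => circleSnd (x.mark i)

/-- The integers on which a coordinate depends. -/
def Coord.support : Coord → Finset ℕ
  | .inl p => {p.1, p.2}
  | .inr (.inl i) => {i}
  | .inr (.inr i) => {i}

lemma bot_eq_induced_indicator (f : Prop → ℝ) (h : f True ≠ f False) :
    (⊥ : TopologicalSpace Prop) = TopologicalSpace.induced f inferInstance := by
  symm
  let : TopologicalSpace Prop := TopologicalSpace.induced f inferInstance
  have hc : Continuous f := continuous_induced_dom
  refine (discreteTopology_iff_isOpen_singleton.2 fun p => ?_ : DiscreteTopology Prop).eq_bot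
  have : ({p} : Set Prop) = f ⁻¹' {f (¬ p)}ᶜ := by
    ext q
    by_cases hp : p <;> by_cases hq : q <;> simp [hp, hq, h, h.symm]
  rw [this]
  exact isOpen_compl_singleton.preimage hc

lemma topology_eq_induced : instTopologicalSpace =
    TopologicalSpace.induced (fun x (c : Coord) => coord c x) inferInstance := by
  classical
  have hpi : (inferInstance : TopologicalSpace (Coord → ℝ)) =
      ⨅ c, TopologicalSpace.induced (fun f : Coord → ℝ => f c) inferInstance := rfl
  rw [hpi, induced_iInf, iInf_sum, iInf_sum, iInf_prod, ← iInf_inf_eq]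
  unfold instTopologicalSpace
  congr 1
  · refine iInf_congr fun i => iInf_congr fun j => ?_
    rw [bot_eq_induced_indicator (fun p => if p then 1 else 0) (by simp), induced_compose,
      induced_compose]
    rfl
  · refine iInf_congr fun i => ?_
    rw [circleTopology_eq_induced, induced_compose, induced_compose, induced_compose]
    change TopologicalSpace.induced _ (_ ⊓ _) = _
    rw [induced_inf, induced_compose, induced_compose]
    rfl

lemma continuous_coord (c : Coord) : Continuous (coord c) := by
  have h : Continuous (fun (x : MarkedPartition) (c : Coord) => coord c x) := by
    rw [continuous_iff_le_induced, ← topology_eq_induced]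
  exact (continuous_apply c).comp h

lemma measurable_coord (c : Coord) : Measurable (coord c) := (continuous_coord c).measurable

lemma measurableSpace_eq_comap : instMeasurableSpace =
    MeasurableSpace.comap (fun x (c : Coord) => coord c x) inferInstance := by
  rw [instMeasurableSpace, topology_eq_induced, borel_comap,
    ← (inferInstance : BorelSpace (Coord → ℝ)).measurable_eq]

lemma measurable_of_coord {β : Type*} {_ : MeasurableSpace β} {f : β → MarkedPartition}
    (h : ∀ c, Measurable fun b => coord c (f b)) : Measurable f := by
  have := measurable_pi_lambda (fun b (c : Coord) => coord c (f b)) h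
  rw [measurableSpace_eq_comap, measurable_comap_iff]
  exact this

lemma measurable_of_rel_mark {β : Type*} {_ : MeasurableSpace β} {f : β → MarkedPartition}
    (hr : ∀ i j, MeasurableSet {b | (f b).rel.r i j}) (hm : ∀ i, Measurable fun b => (f b).mark i) :
    Measurable f := by
  refine measurable_of_coord fun c => ?_
  rcases c with ⟨i, j⟩ | i | i
  · exact Measurable.ite (hr i j) measurable_const measurable_const
  · exact continuous_circleFst.measurable.comp (hm i)
  · exact continuous_circleSnd.measurable.comp (hm i)

lemma mark_eq_coord (x : MarkedPartition) (i : ℕ) :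
    (x.mark i : ℝ) = coord (.inr (.inr i)) x / coord (.inr (.inl i)) x :=
  (circleSnd_div_circleFst _).symm

/-- The coordinate takes only the values `0` and `1`, so a distance below `1 / 2` to the limit means
equality. -/
lemma eventually_rel_of_tendsto {ι : Type*} {f : Filter ι}
    {x' : ι → MarkedPartition} {x : MarkedPartition} {i j : ℕ}
    (h : Tendsto (fun n => coord (.inl (i, j)) (x' n)) f (𝓝 (coord (.inl (i, j)) x))) :
    ∀ᶠ n in f, ((x' n).rel.r i j ↔ x.rel.r i j) := by
  filter_upwards [h.eventually (Metric.ball_mem_nhds _ one_half_pos)] with s hs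
  rw [Real.dist_eq] at hs
  by_cases h1 : (x' s).rel.r i j <;> by_cases h2 : x.rel.r i j <;>
    simp only [h1, h2, coord, if_true, if_false] at hs ⊢ <;> norm_num at hs

/-- The block and the mark of an integer. -/
def blockMark (i : ℕ) (x : MarkedPartition) : Set ℕ × ℝ≥0 := (x.block i, x.mark i)

lemma measurable_blockMark (i : ℕ) : Measurable (blockMark i) :=
  (measurable_block i).prodMk (measurable_mark i)

end MarkedPartition

/-! ### Measurability -/

namespace MarkedPartition

lemma blockMin_le (x : MarkedPartition) (i : ℕ) : x.blockMin i ≤ i := Nat.sInf_le (x.rel.refl' i)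

lemma rel_blockMin (x : MarkedPartition) (i : ℕ) : x.rel.r i (x.blockMin i) :=
  Nat.sInf_mem (s := x.block i) ⟨i, x.rel.refl' i⟩

lemma block_eq_of_rel (x : MarkedPartition) {i j : ℕ} (h : x.rel.r i j) :
    x.block i = x.block j := by
  ext k
  exact ⟨fun hk => x.rel.trans' (x.rel.symm' h) hk, fun hk => x.rel.trans' h hk⟩

lemma blockMin_eq_iff {x : MarkedPartition} {i j : ℕ} :
    x.blockMin i = x.blockMin j ↔ x.rel.r i j := by
  constructor
  · intro h
    have h1 := x.rel_blockMin i
    rw [h] at h1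
    exact x.rel.trans' h1 (x.rel.symm' (x.rel_blockMin j))
  · intro h
    rw [blockMin, blockMin, x.block_eq_of_rel h]

lemma blockMin_eq_iff_forall {x : MarkedPartition} {i n : ℕ} :
    x.blockMin i = n ↔ x.rel.r i n ∧ ∀ m < n, ¬ x.rel.r i m := by
  constructor
  · rintro rfl
    exact ⟨x.rel_blockMin i, fun m hm h => Nat.notMem_of_lt_sInf hm h⟩
  · rintro ⟨h1, h2⟩
    refine le_antisymm (Nat.sInf_le h1) (le_of_not_gt fun h => h2 _ h (x.rel_blockMin i))

lemma measurable_blockMin (i : ℕ) : Measurable fun x : MarkedPartition => x.blockMin i := by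
  refine measurable_to_countable' fun n => ?_
  have : (fun x : MarkedPartition => x.blockMin i) ⁻¹' {n} =
      {x | x.rel.r i n ∧ ∀ m < n, ¬ x.rel.r i m} := by
    ext x
    exact blockMin_eq_iff_forall
  rw [this]
  have := measurable_rel
  measurability

/-- Since `x.blockMin i ≤ i`, the range of summation can be made independent of `x`, which gives
measurability and locality of the label. -/
lemma label_eq_sum (x : MarkedPartition) (i : ℕ) : x.label i =
    ∑ j ∈ Finset.range i, if j < x.blockMin i ∧ x.blockMin j = j then 1 else 0 := by
  rw [label, ← Finset.sum_filter, Finset.sum_const, smul_eq_mul, mul_one]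
  congr 1
  ext j
  have := x.blockMin_le i
  simp only [Finset.mem_filter, Finset.mem_range]
  omega

lemma measurable_label (i : ℕ) : Measurable fun x : MarkedPartition => x.label i := by
  simp_rw [label_eq_sum]
  refine Finset.measurable_fun_sum _ fun j _ => ?_
  refine Measurable.ite ?_ measurable_const measurable_const
  exact (measurableSet_lt measurable_const (measurable_blockMin i)).inter
    (measurable_blockMin j (measurableSet_singleton j))

/-- The label of `i` depends only on the restriction of the partition to `{0, …, i}`. -/
lemma label_congr {x y : MarkedPartition} {i : ℕ}
    (h : ∀ j ≤ i, ∀ k ≤ i, (x.rel.r j k ↔ y.rel.r j k)) : x.label i = y.label i := by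
  have hb : ∀ j ≤ i, x.blockMin j = y.blockMin j := by
    intro j hj
    rw [blockMin_eq_iff_forall]
    have hle := (y.blockMin_le j).trans hj
    refine ⟨(h j hj _ hle).2 (y.rel_blockMin j), fun m hm => ?_⟩
    rw [h j hj m (hm.le.trans hle)]
    exact (blockMin_eq_iff_forall.1 rfl).2 m hm
  rw [label_eq_sum, label_eq_sum]
  refine Finset.sum_congr rfl fun j hj => ?_
  rw [hb i le_rfl, hb j (Finset.mem_range.1 hj).le]

/-- The least element of the block of `i` is counted in the label of `j` but not in that of `i`. -/
lemma blockMin_lt_of_not_rel {x : MarkedPartition} {i j : ℕ} (h : x.blockMin i < x.blockMin j) :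
    x.label i < x.label j := by
  unfold label
  refine Finset.card_lt_card (Finset.ssubset_iff_of_subset ?_ |>.2 ⟨x.blockMin i, ?_, ?_⟩)
  · intro k
    simp only [Finset.mem_filter, Finset.mem_range]
    exact fun hk => ⟨hk.1.trans h, hk.2⟩
  · simp only [Finset.mem_filter, Finset.mem_range]
    exact ⟨h, blockMin_eq_iff.2 (x.rel.symm' (x.rel_blockMin i))⟩
  · simp

lemma label_eq_iff {x : MarkedPartition} {i j : ℕ} : x.label i = x.label j ↔ x.rel.r i j := by
  refine ⟨fun h => ?_, fun h => x.label_eq h⟩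
  rw [← blockMin_eq_iff]
  rcases lt_trichotomy (x.blockMin i) (x.blockMin j) with h' | h' | h'
  · exact absurd h (blockMin_lt_of_not_rel h').ne
  · exact h'
  · exact absurd h (blockMin_lt_of_not_rel h').ne'

end MarkedPartition

lemma measurable_markPow (α : ℝ) : Measurable fun v : ℝ≥0 => markPow v α :=
  Measurable.ite (measurableSet_singleton 0) measurable_const (by fun_prop)

/-! ### Right continuity and approximation along grids. -/

namespace IsCadlag

variable {x : ℝ≥0 → MarkedPartition}

lemma tendsto_coord (hx : IsCadlag x) (c : Coord) (t : ℝ≥0) :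
    Tendsto (fun s => coord c (x s)) (𝓝[≥] t) (𝓝 (coord c (x t))) :=
  ((continuous_coord c).tendsto _).comp (hx t).1

lemma exists_tendsto_coord (hx : IsCadlag x) (c : Coord) (t : ℝ≥0) :
    ∃ l, Tendsto (fun s => coord c (x s)) (𝓝[<] t) (𝓝 l) := by
  obtain ⟨l, hl⟩ := (hx t).2
  exact ⟨_, ((continuous_coord c).tendsto l).comp hl⟩

lemma tendsto_rel (hx : IsCadlag x) {i j : ℕ} {t : ℝ≥0} {u : ℕ → ℝ≥0}
    (hu : Tendsto u atTop (𝓝[≥] t)) : ∀ᶠ n in atTop, ((x (u n)).rel.r i j ↔ (x t).rel.r i j) :=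
  eventually_rel_of_tendsto ((hx.tendsto_coord (.inl (i, j)) t).comp hu)

end IsCadlag

/-- The smallest multiple of `1 / (n + 1)` above `s`. -/
noncomputable def gridCeil (n : ℕ) (s : ℝ≥0) : ℝ≥0 := ⌈(n + 1) * s⌉₊ / (n + 1)

lemma le_gridCeil (n : ℕ) (s : ℝ≥0) : s ≤ gridCeil n s := by
  rw [gridCeil, le_div_iff₀ (by positivity), mul_comm]
  exact Nat.le_ceil _

lemma gridCeil_le (n : ℕ) (s : ℝ≥0) : gridCeil n s ≤ s + 1 / (n + 1) := by
  rw [gridCeil, div_le_iff₀ (by positivity), add_mul s, div_mul_cancel₀ _ (by positivity),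
    mul_comm s]
  exact (Nat.ceil_lt_add_one zero_le).le

lemma tendsto_gridCeil (s : ℝ≥0) : Tendsto (fun n => gridCeil n s) atTop (𝓝[≥] s) := by
  refine tendsto_nhdsWithin_iff.2 ⟨?_, Eventually.of_forall fun n => le_gridCeil n s⟩
  have h : Tendsto (fun n : ℕ => s + 1 / ((n : ℝ≥0) + 1)) atTop (𝓝 (s + 0)) :=
    tendsto_const_nhds.add tendsto_one_div_add_atTop_nhds_zero_nat
  rw [add_zero] at h
  exact tendsto_of_tendsto_of_tendsto_of_le_of_le tendsto_const_nhds h (fun n => le_gridCeil n s)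
    (fun n => gridCeil_le n s)

lemma measurable_gridCeil_index (n : ℕ) : Measurable fun s : ℝ≥0 => ⌈((n : ℝ≥0) + 1) * s⌉₊ :=
  Nat.measurable_ceil.comp (measurable_const.mul measurable_id)

lemma measurable_comp_nat {β γ : Type*} {_ : MeasurableSpace β} {_ : MeasurableSpace γ}
    {F : ℕ → β → γ} (hF : ∀ n, Measurable (F n)) {k : β → ℕ} (hk : Measurable k) :
    Measurable fun b => F (k b) b :=
  (measurable_from_prod_countable_right (f := fun p : ℕ × β => F p.1 p.2) hF).comp
    (hk.prodMk measurable_id)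

section Measurability

variable {Ω : Type*} [MeasurableSpace Ω] {X : ℝ≥0 → Ω → MarkedPartition}
  {β : Type*} [MeasurableSpace β]

/-- On a grid the random time has countably many values; right continuity passes to the limit in
each real coordinate. -/
lemma measurable_eval (hm : ∀ t, Measurable (X t)) (hc : ∀ ω, IsCadlag fun t => X t ω)
    {τ : β → ℝ≥0} (hτ : Measurable τ) {g : β → Ω} (hg : Measurable g) :
    Measurable fun b => X (τ b) (g b) := by
  refine measurable_of_coord fun c => ?_
  refine measurable_of_tendsto_metrizable (f := fun n b => coord c (X (gridCeil n (τ b)) (g b)))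
    (fun n => ?_) ?_
  · exact measurable_comp_nat (F := fun k b => coord c (X ((k : ℝ≥0) / (n + 1)) (g b)))
      (fun k => (measurable_coord c).comp ((hm _).comp hg))
      ((measurable_gridCeil_index n).comp hτ)
  · rw [tendsto_pi_nhds]
    exact fun b => ((hc (g b)).tendsto_coord c (τ b)).comp (tendsto_gridCeil (τ b))

/-- A relation is discrete-valued and right-continuous, so its value at `t` is attained at grid
points above `t`. This reduces the uncountable condition to countably many times. -/
lemma atInfinity_rel_iff {x : ℝ≥0 → MarkedPartition} (hx : IsCadlag x) (i j : ℕ) :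
    (atInfinity x).rel.r i j ↔
      ∃ N : ℕ, ∀ n k : ℕ, (N : ℝ≥0) ≤ (k : ℝ≥0) / (n + 1) →
        (x ((k : ℝ≥0) / (n + 1))).rel.r i j := by
  change (∀ᶠ t in atTop, (x t).rel.r i j) ↔ _
  rw [eventually_atTop]
  constructor
  · rintro ⟨a, ha⟩
    obtain ⟨N, hN⟩ := exists_nat_ge a
    exact ⟨N, fun n k h => ha _ (hN.trans h)⟩
  · rintro ⟨N, hN⟩
    refine ⟨N, fun t ht => ?_⟩
    obtain ⟨n, hn⟩ := (hx.tendsto_rel (i := i) (j := j) (tendsto_gridCeil t)).exists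
    exact hn.1 (hN n _ (ht.trans (le_gridCeil n t)))

lemma measurable_atInfinity (hm : ∀ t, Measurable (X t)) (hc : ∀ ω, IsCadlag fun t => X t ω) :
    Measurable fun ω => atInfinity fun t => X t ω := by
  refine measurable_of_rel_mark (fun i j => ?_) (fun i => measurable_const)
  simp_rw [fun ω => atInfinity_rel_iff (hc ω) i j]
  have h : ∀ t, MeasurableSet {ω | (X t ω).rel.r i j} := fun t =>
    measurableSet_setOfPred.2 ((measurable_rel i j).comp (hm t))
  simp only [ofPred_exists, ofPred_forall]
  exact .iUnion fun N => .iInter fun n => .iInter fun k => .iInter fun _ => h _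

lemma measurable_atTime (hm : ∀ t, Measurable (X t)) (hc : ∀ ω, IsCadlag fun t => X t ω)
    {l : Ω → ℝ≥0∞} (hl : Measurable l) : Measurable fun ω => atTime (fun t => X t ω) (l ω) :=
  Measurable.ite (hl (measurableSet_singleton ∞)) (measurable_atInfinity hm hc)
    (measurable_eval hm hc hl.ennreal_toNNReal measurable_id)

lemma measurable_stoppedValueAt (hm : ∀ t, Measurable (X t)) (hc : ∀ ω, IsCadlag fun t => X t ω)
    {l : ℕ → Ω → ℝ≥0∞} (hl : ∀ i, Measurable (l i)) : Measurable (stoppedValueAt X l) := by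
  refine measurable_of_rel_mark (fun i j => ?_) fun i => ?_
  · exact (measurableSet_eq_fun (hl i) (hl j)).inter
      (measurableSet_setOfPred.2 ((measurable_rel i j).comp (measurable_atTime hm hc (hl i))))
  · have h := (measurable_mark i).comp (measurable_atTime hm hc (hl i))
    exact h

/-- Both the copy and the time at which it is read are random, through the label and the mark of the
block. -/
lemma measurable_ssfrag (hm : ∀ t, Measurable (X t)) (hc : ∀ ω, IsCadlag fun t => X t ω) (α : ℝ)
    {f : β → MarkedPartition} (hf : Measurable f) {g : β → ℕ → Ω} (hg : Measurable g) :
    Measurable fun b => ssfrag α (f b) fun k t => X t (g b k) := by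
  refine measurable_pi_lambda _ fun t => ?_
  have key : ∀ i, Measurable fun b =>
      X (markPow ((f b).mark i) α * t) (g b ((f b).label i)) := fun i =>
    measurable_eval hm hc
      (((measurable_markPow α).comp ((measurable_mark i).comp hf)).mul measurable_const)
      (measurable_comp_nat (F := fun k b => g b k) (fun k => (measurable_pi_apply k).comp hg)
        ((measurable_label i).comp hf))
  refine measurable_of_rel_mark (fun i j => ?_) fun i => ?_
  · exact (measurableSet_setOfPred.2 ((measurable_rel i j).comp hf)).inter
      (measurableSet_setOfPred.2 ((measurable_rel i j).comp (key i)))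
  · exact ((measurable_mark i).comp hf).mul ((measurable_mark i).comp (key i))

lemma IsStoppingLine.measurable {hm : ∀ t, Measurable (X t)} {Q : Measure Ω}
    {L : ℕ → Ω → ℝ≥0∞} (hL : IsStoppingLine X hm Q L) (i : ℕ) : Measurable (L i) := by
  refine measurable_of_Iic fun a => ?_
  induction a with
  | top => simp
  | coe a => exact (blockFiltration X hm i).le a _ (hL.isStoppingTime i a)

end Measurability

/-! ### Paths of a block, and independence of the evolutions of distinct blocks -/

/-- The path of the block and mark of `i`. -/
def blockPath (i : ℕ) (x : ℝ≥0 → MarkedPartition) : ℝ≥0 → Set ℕ × ℝ≥0 := fun t => blockMark i (x t)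

lemma measurable_blockPath (i : ℕ) : Measurable (blockPath i) :=
  measurable_pi_lambda _ fun t => (measurable_blockMark i).comp (measurable_pi_apply t)

lemma measurableSet_forall_blockPath (J : Finset ℕ) {D : ℕ → Set (ℝ≥0 → Set ℕ × ℝ≥0)}
    (hD : ∀ i, MeasurableSet (D i)) : MeasurableSet {x | ∀ i ∈ J, blockPath i x ∈ D i} := by
  simp only [ofPred_forall]
  exact J.measurableSet_biInter fun i _ => measurable_blockPath i (hD i)

/-- The path of the block and mark of `i` when the block `B` of mark `v` fragments according to
`x`. -/
noncomputable def scaledBlockPath (α : ℝ) (i : ℕ) (b : Set ℕ × ℝ≥0) (x : ℝ≥0 → MarkedPartition) :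
    ℝ≥0 → Set ℕ × ℝ≥0 :=
  fun t => (b.1 ∩ (x (markPow b.2 α * t)).block i, b.2 * (x (markPow b.2 α * t)).mark i)

lemma measurable_scaledBlockPath (α : ℝ) (i : ℕ) (b : Set ℕ × ℝ≥0) :
    Measurable (scaledBlockPath α i b) := by
  refine measurable_pi_lambda _ fun t => Measurable.prodMk ?_ ?_
  · refine measurable_set_iff.2 fun j => ?_
    exact measurable_const.and ((measurable_rel i j).comp (measurable_pi_apply _))
  · exact measurable_const.mul ((measurable_mark i).comp (measurable_pi_apply _))

lemma blockPath_ssfrag (α : ℝ) (x : MarkedPartition) (y : ℕ → ℝ≥0 → MarkedPartition) (i : ℕ) :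
    blockPath i (ssfrag α x y) = scaledBlockPath α i (blockMark i x) (y (x.label i)) := rfl

namespace IsESSF

variable {Ω : Type*} [MeasurableSpace Ω] {α : ℝ} {X : ℝ≥0 → Ω → MarkedPartition}
  {P : Kernel MarkedPartition Ω} [IsMarkovKernel P]

lemma measurable_path (hX : IsESSF α X P) : Measurable fun ω t => X t ω :=
  measurable_pi_lambda _ hX.measurable

lemma prob_eq_infinitePi (hX : IsESSF α X P) (x : MarkedPartition)
    {C : Set (ℝ≥0 → MarkedPartition)} (hC : MeasurableSet C) :
    P x {ω | (fun t => X t ω) ∈ C} = (Measure.infinitePi fun _ : ℕ => P one)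
      {ω | (ssfrag α x fun k t => X t (ω k)) ∈ C} := by
  have h := DFunLike.congr_fun (hX.branching x) C
  rw [Measure.map_apply hX.measurable_path hC, Measure.map_apply _ hC] at h
  · exact h
  · exact measurable_ssfrag hX.measurable hX.cadlag α measurable_const measurable_id

/-- Each block uses its own copy, so the probability is a product over blocks. Blocks are indexed by
their least elements rather than by their labels: a label depends on the other blocks, a least
element does not, and this makes factors comparable between different partitions. -/
lemma prob_blockPath (hX : IsESSF α X P) (x : MarkedPartition) (J : Finset ℕ)
    {D : ℕ → Set (ℝ≥0 → Set ℕ × ℝ≥0)} (hD : ∀ i, MeasurableSet (D i)) :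
    P x {ω | ∀ i ∈ J, blockPath i (fun t => X t ω) ∈ D i} =
      ∏ m ∈ J.image x.blockMin, P one {ω | ∀ i ∈ J, x.blockMin i = m →
        scaledBlockPath α i (blockMark i x) (fun t => X t ω) ∈ D i} := by
  have hmin : ∀ i, x.blockMin (x.blockMin i) = x.blockMin i := fun i =>
    blockMin_eq_iff.2 (x.rel.symm' (x.rel_blockMin i))
  have hlab : ∀ i j, x.label i = x.label j ↔ x.blockMin i = x.blockMin j := fun i j => by
    rw [label_eq_iff, blockMin_eq_iff]
  let E : ℕ → Set Ω := fun k => {ω | ∀ i ∈ J, x.label i = k →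
        scaledBlockPath α i (blockMark i x) (fun t => X t ω) ∈ D i}
  have hE : ∀ k, MeasurableSet (E k) := fun k => by
    simp only [E, ofPred_forall]
    refine J.measurableSet_biInter fun i _ => .iInter fun _ => ?_
    exact (measurable_scaledBlockPath α i _).comp hX.measurable_path (hD i)
  have h1 := hX.prob_eq_infinitePi x (measurableSet_forall_blockPath J hD)
  have h2 : {ω : ℕ → Ω | (ssfrag α x fun k t => X t (ω k)) ∈ {x | ∀ i ∈ J, blockPath i x ∈ D i}} =
      Set.pi (J.image x.label) E := by
    ext ω
    simp only [mem_ofPred_eq, blockPath_ssfrag, Set.mem_pi, Finset.coe_image, mem_image,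
      Finset.mem_coe, E]
    constructor
    · rintro h k ⟨j, hj, rfl⟩ i hi hij
      rw [← hij]
      exact h i hi
    · intro h i hi
      exact h _ ⟨i, hi, rfl⟩ i hi rfl
  rw [h2, Measure.infinitePi_pi _ (fun i _ => hE i)] at h1
  rw [show {ω | ∀ i ∈ J, blockPath i (fun t => X t ω) ∈ D i} =
    {ω | (fun t => X t ω) ∈ {x | ∀ i ∈ J, blockPath i x ∈ D i}} from rfl, h1]
  have h3 : J.image x.label = (J.image x.blockMin).image x.label := by
    rw [Finset.image_image]
    refine Finset.image_congr fun i _ => ?_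
    rw [Function.comp_apply, hlab, hmin]
  rw [h3, Finset.prod_image]
  · refine Finset.prod_congr rfl fun m hm => ?_
    obtain ⟨j, _, rfl⟩ := Finset.mem_image.1 hm
    simp only [E, hlab, hmin]
  · intro m hm m' hm' h
    obtain ⟨j, _, rfl⟩ := Finset.mem_image.1 (Finset.mem_coe.1 hm)
    obtain ⟨j', _, rfl⟩ := Finset.mem_image.1 (Finset.mem_coe.1 hm')
    rwa [hlab, hmin, hmin] at h

/-- The law of the evolution of some blocks depends only on these blocks. -/
lemma prob_blockPath_congr (hX : IsESSF α X P) {x y : MarkedPartition} {J : Finset ℕ}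
    {D : ℕ → Set (ℝ≥0 → Set ℕ × ℝ≥0)} (hD : ∀ i, MeasurableSet (D i))
    (h : ∀ i ∈ J, blockMark i x = blockMark i y) :
    P x {ω | ∀ i ∈ J, blockPath i (fun t => X t ω) ∈ D i} =
      P y {ω | ∀ i ∈ J, blockPath i (fun t => X t ω) ∈ D i} := by
  have hm : ∀ i ∈ J, x.blockMin i = y.blockMin i := fun i hi =>
    congrArg sInf (congrArg Prod.fst (h i hi))
  rw [hX.prob_blockPath x J hD, hX.prob_blockPath y J hD, Finset.image_congr hm]
  refine Finset.prod_congr rfl fun m _ => congrArg _ ?_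
  ext ω
  refine forall₂_congr fun i hi => ?_
  rw [hm i hi, h i hi]

/-- Evolutions of distinct blocks are independent. -/
lemma prob_blockPath_and (hX : IsESSF α X P) {x : MarkedPartition} {I J : Finset ℕ}
    (hIJ : ∀ i ∈ I, ∀ j ∈ J, ¬ x.rel.r i j) {D E : ℕ → Set (ℝ≥0 → Set ℕ × ℝ≥0)}
    (hD : ∀ i, MeasurableSet (D i)) (hE : ∀ i, MeasurableSet (E i)) :
    P x {ω | (∀ i ∈ I, blockPath i (fun t => X t ω) ∈ D i) ∧
        ∀ i ∈ J, blockPath i (fun t => X t ω) ∈ E i} =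
      P x {ω | ∀ i ∈ I, blockPath i (fun t => X t ω) ∈ D i} *
        P x {ω | ∀ i ∈ J, blockPath i (fun t => X t ω) ∈ E i} := by
  classical
  have hd : ∀ i ∈ J, i ∉ I := fun i hi hi' => hIJ i hi' i hi (x.rel.refl' i)
  -- Separated integers are distinct, so `I` and `J` are disjoint and the two families of
  -- constraints glue into one.
  let F : ℕ → Set (ℝ≥0 → Set ℕ × ℝ≥0) := fun i => if i ∈ I then D i else E i
  have hF : ∀ i, MeasurableSet (F i) := fun i => by
    by_cases hi : i ∈ I <;> simp [F, hi, hD, hE]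
  have hFD : ∀ i ∈ I, F i = D i := fun i hi => if_pos hi
  have hFE : ∀ i ∈ J, F i = E i := fun i hi => if_neg (hd i hi)
  have e1 : {ω | (∀ i ∈ I, blockPath i (fun t => X t ω) ∈ D i) ∧
        ∀ i ∈ J, blockPath i (fun t => X t ω) ∈ E i} =
      {ω | ∀ i ∈ I ∪ J, blockPath i (fun t => X t ω) ∈ F i} := by
    ext ω
    simp only [mem_ofPred_eq, Finset.mem_union, or_imp, forall_and]
    refine and_congr (forall₂_congr fun i hi => ?_) (forall₂_congr fun i hi => ?_)
    · rw [hFD i hi]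
    · rw [hFE i hi]
  have hne : ∀ i ∈ I, ∀ j ∈ J, x.blockMin i ≠ x.blockMin j := fun i hi j hj h =>
    hIJ i hi j hj (blockMin_eq_iff.1 h)
  rw [e1, hX.prob_blockPath x _ hF, hX.prob_blockPath x _ hD, hX.prob_blockPath x _ hE,
    Finset.image_union, Finset.prod_union]
  · congr 1
    · refine Finset.prod_congr rfl fun m hm => congrArg _ ?_
      obtain ⟨j, hj, rfl⟩ := Finset.mem_image.1 hm
      ext ω
      refine forall_congr' fun i => ⟨fun h hi => ?_, fun h hi hij => ?_⟩
      · rw [← hFD i hi]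
        exact h (Finset.mem_union_left _ hi)
      · rcases Finset.mem_union.1 hi with hi | hi
        · rw [hFD i hi]
          exact h hi hij
        · exact absurd hij.symm (hne j hj i hi)
    · refine Finset.prod_congr rfl fun m hm => congrArg _ ?_
      obtain ⟨j, hj, rfl⟩ := Finset.mem_image.1 hm
      ext ω
      refine forall_congr' fun i => ⟨fun h hi => ?_, fun h hi hij => ?_⟩
      · rw [← hFE i hi]
        exact h (Finset.mem_union_right _ hi)
      · rcases Finset.mem_union.1 hi with hi | hi
        · exact absurd hij (hne i hi j hj)
        · rw [hFE i hi]
          exact h hi hij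
  · rw [Finset.disjoint_left]
    intro m hm hm'
    obtain ⟨i, hi, rfl⟩ := Finset.mem_image.1 hm
    obtain ⟨j, hj, h⟩ := Finset.mem_image.1 hm'
    exact hne i hi j hj h.symm

/-- Evolutions of finitely many groups of distinct blocks are independent. -/
lemma prob_blockPath_prod {ι : Type*} [DecidableEq ι] (hX : IsESSF α X P) {x : MarkedPartition}
    {J : Finset ℕ} {l : ℕ → ι} (hl : ∀ i ∈ J, ∀ j ∈ J, x.rel.r i j → l i = l j)
    {D : ℕ → Set (ℝ≥0 → Set ℕ × ℝ≥0)} (hD : ∀ i, MeasurableSet (D i)) (T : Finset ι) :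
    P x {ω | ∀ i ∈ J.filter (l · ∈ T), blockPath i (fun t => X t ω) ∈ D i} =
      ∏ t ∈ T, P x {ω | ∀ i ∈ J.filter (l · = t), blockPath i (fun t => X t ω) ∈ D i} := by
  induction T using Finset.induction_on with
  | empty => simp
  | insert a T ha ih =>
    rw [Finset.prod_insert ha, ← ih, ← hX.prob_blockPath_and _ hD hD]
    · congr 1
      ext ω
      simp only [Finset.mem_filter, Finset.mem_insert, mem_ofPred_eq, and_or_left, or_imp,
        forall_and]
    · intro i hi j hj h
      rw [Finset.mem_filter] at hi hj
      have := hl i hi.1 j hj.1 h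
      rw [hi.2] at this
      exact ha (this ▸ hj.2)

end IsESSF

/-! ### The Markov property and regularity of paths -/

/-- A càdlàg path whose value for `i` is the same at all rational times is constant. -/
lemma IsCadlag.blockMark_eq_of_forall_grid {x : ℝ≥0 → MarkedPartition} (hx : IsCadlag x) {i : ℕ}
    {s : ℝ≥0} {b : Set ℕ × ℝ≥0} (h : ∀ n k : ℕ, blockMark i (x (s + k / (n + 1))) = b)
    (t : ℝ≥0) : blockMark i (x (s + t)) = b := by
  have hu : Tendsto (fun n => s + gridCeil n t) atTop (𝓝[≥] (s + t)) := by
    refine tendsto_nhdsWithin_iff.2 ⟨?_, Eventually.of_forall fun n => ?_⟩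
    · exact tendsto_const_nhds.add (tendsto_nhdsWithin_iff.1 (tendsto_gridCeil t)).1
    · exact add_le_add_right (le_gridCeil n t) s
  have hu' : ∀ n, blockMark i (x (s + gridCeil n t)) = b := fun n => h n _
  refine Prod.ext ?_ ?_
  · ext j
    obtain ⟨n, hn⟩ := (hx.tendsto_rel (i := i) (j := j) hu).exists
    rw [← hu' n]
    exact hn.symm
  -- The mark converges only in the circle, so it is recovered from its two real coordinates.
  · have key : ∀ c : Coord, (∀ n, coord c (x (s + gridCeil n t)) = coord c (x (s + gridCeil 0 t))) →
        coord c (x (s + t)) = coord c (x (s + gridCeil 0 t)) := fun c hc =>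
      tendsto_nhds_unique ((hx.tendsto_coord c _).comp hu)
        (tendsto_const_nhds.congr fun n => (hc n).symm)
    have hm : ∀ n, (x (s + gridCeil n t)).mark i = b.2 := fun n => congrArg Prod.snd (hu' n)
    have h1 := key (.inr (.inl i)) fun n => by simp [coord, hm]
    have h2 := key (.inr (.inr i)) fun n => by simp [coord, hm]
    have h3 := mark_eq_coord (x (s + t)) i
    rw [h1, h2, ← mark_eq_coord, hm] at h3
    exact_mod_cast h3

lemma measurableSet_blockMark_eq {β : Type*} [MeasurableSpace β] {f g : β → Set ℕ × ℝ≥0}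
    (hf : Measurable f) (hg : Measurable g) : MeasurableSet {b | f b = g b} := by
  have h : {b | f b = g b} =
      {b | (f b).2 = (g b).2} ∩ ⋂ j, {b | j ∈ (f b).1 ↔ j ∈ (g b).1} := by
    ext b
    simp [Prod.ext_iff, Set.ext_iff, and_comm]
  rw [h]
  refine (measurableSet_eq_fun hf.snd hg.snd).inter (.iInter fun j => ?_)
  exact measurableSet_setOfPred.2 ((measurable_set_iff.1 hf.fst j).iff
    (measurable_set_iff.1 hg.fst j))

namespace IsESSF

variable {Ω : Type*} [MeasurableSpace Ω] {α : ℝ} {X : ℝ≥0 → Ω → MarkedPartition}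
  {P : Kernel MarkedPartition Ω} [IsMarkovKernel P]

lemma measurable_prob_path (hX : IsESSF α X P) {C : Set (ℝ≥0 → MarkedPartition)}
    (hC : MeasurableSet C) : Measurable fun x => P x {ω | (fun t => X t ω) ∈ C} :=
  P.measurable_coe (hX.measurable_path hC)

lemma measurable_stoppingTime {f : Filtration ℝ≥0 (inferInstance : MeasurableSpace Ω)}
    {τ : Ω → ℝ≥0∞} (hτ : IsStoppingTime f τ) : Measurable τ := by
  refine measurable_of_Iic fun a => ?_
  induction a with
  | top => simp
  | coe a => exact f.le a _ (hτ a)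

lemma measurable_shift (hX : IsESSF α X P) {τ : Ω → ℝ≥0} (hτ : Measurable τ) :
    Measurable fun ω t => X (τ ω + t) ω :=
  measurable_pi_lambda _ fun _ =>
    measurable_eval hX.measurable hX.cadlag (hτ.add_const _) measurable_id

/-- The strong Markov property for an arbitrary initial law. -/
lemma strong_markov_bind (hX : IsESSF α X P) (μ : Measure MarkedPartition) {τ : Ω → ℝ≥0∞}
    (hτ : IsStoppingTime (naturalFiltration X hX.measurable) τ) {A : Set Ω}
    (hA : MeasurableSet[hτ.measurableSpace] A) {C : Set (ℝ≥0 → MarkedPartition)}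
    (hC : MeasurableSet C) :
    μ.bind P (A ∩ {ω | τ ω < ∞ ∧ (fun t => X ((τ ω).toNNReal + t) ω) ∈ C}) =
      ∫⁻ ω in A ∩ {ω | τ ω < ∞}, P (X (τ ω).toNNReal ω) {ω' | (fun t => X t ω') ∈ C}
        ∂(μ.bind P) := by
  have hτm : Measurable τ := measurable_stoppingTime hτ
  have hAm : MeasurableSet A := hτ.measurableSpace_le _ hA
  have hfin : MeasurableSet {ω | τ ω < ∞} := hτm measurableSet_Iio
  have hS : MeasurableSet (A ∩ {ω | τ ω < ∞ ∧ (fun t => X ((τ ω).toNNReal + t) ω) ∈ C}) :=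
    hAm.inter (hfin.inter (hX.measurable_shift hτm.ennreal_toNNReal hC))
  have hf : Measurable fun ω => P (X (τ ω).toNNReal ω) {ω' | (fun t => X t ω') ∈ C} :=
    (hX.measurable_prob_path hC).comp
      (measurable_eval hX.measurable hX.cadlag hτm.ennreal_toNNReal measurable_id)
  rw [Measure.bind_apply hS P.measurable.aemeasurable, ← lintegral_indicator (hAm.inter hfin),
    Measure.lintegral_bind P.measurable.aemeasurable
      (hf.indicator (hAm.inter hfin)).aemeasurable]
  refine lintegral_congr fun x => ?_
  rw [lintegral_indicator (hAm.inter hfin)]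
  exact hX.strong_markov x τ hτ A hA C hC

lemma markov_bind (hX : IsESSF α X P) (μ : Measure MarkedPartition) [IsProbabilityMeasure μ]
    (t : ℝ≥0) {A : Set Ω}
    (hA : MeasurableSet[naturalFiltration X hX.measurable t] A)
    {C : Set (ℝ≥0 → MarkedPartition)} (hC : MeasurableSet C) :
    μ.bind P (A ∩ {ω | (fun s => X (t + s) ω) ∈ C}) =
      ∫⁻ ω in A, P (X t ω) {ω' | (fun s => X s ω') ∈ C} ∂(μ.bind P) := by
  have h := hX.strong_markov_bind μ (τ := fun _ => (t : ℝ≥0∞))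
    (isStoppingTime_const _ t) (A := A) (by
      have := IsStoppingTime.measurableSpace_const (naturalFiltration X hX.measurable) t
      exact this.symm ▸ hA) hC
  simpa using h

/-- The Markov property, with a weight that depends on the past. -/
lemma markov_lintegral (hX : IsESSF α X P) (μ : Measure MarkedPartition) [IsProbabilityMeasure μ]
    (t : ℝ≥0) {G : Ω → ℝ≥0∞} (hG : Measurable[naturalFiltration X hX.measurable t] G)
    {C : Set (ℝ≥0 → MarkedPartition)} (hC : MeasurableSet C) :
    ∫⁻ ω in {ω | (fun s => X (t + s) ω) ∈ C}, G ω ∂(μ.bind P) =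
      ∫⁻ ω, G ω * P (X t ω) {ω' | (fun s => X s ω') ∈ C} ∂(μ.bind P) := by
  have hle := (naturalFiltration X hX.measurable).le t
  have hf : Measurable fun ω => P (X t ω) {ω' | (fun s => X s ω') ∈ C} :=
    (hX.measurable_prob_path hC).comp (hX.measurable t)
  -- The Markov property states that these two measures agree on the past; hence they give the same
  -- integral to functions of the past.
  have key : ((μ.bind P).restrict {ω | (fun s => X (t + s) ω) ∈ C}).trim hle =
      ((μ.bind P).withDensity fun ω => P (X t ω) {ω' | (fun s => X s ω') ∈ C}).trim hle := by
    refine @Measure.ext _ (naturalFiltration X hX.measurable t) _ _ fun A hA => ?_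
    rw [trim_measurableSet_eq hle hA, trim_measurableSet_eq hle hA,
      Measure.restrict_apply (hle _ hA), withDensity_apply _ (hle _ hA), hX.markov_bind μ t hA hC]
  rw [← lintegral_trim hle hG, key, lintegral_trim hle hG,
    lintegral_withDensity_eq_lintegral_mul _ hf (hG.mono hle le_rfl)]
  simp only [Pi.mul_apply, mul_comm]

/-- Conditionally on the past, distinct blocks evolve independently. -/
lemma markov_blocks (hX : IsESSF α X P) (μ : Measure MarkedPartition) [IsProbabilityMeasure μ]
    (t : ℝ≥0) {G : Ω → ℝ≥0∞} (hG : Measurable[naturalFiltration X hX.measurable t] G)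
    {I J : Finset ℕ} (hIJ : ∀ ω, G ω ≠ 0 → ∀ i ∈ I, ∀ j ∈ J, ¬ (X t ω).rel.r i j)
    {D E : ℕ → Set (ℝ≥0 → Set ℕ × ℝ≥0)}
    (hD : ∀ i, MeasurableSet (D i)) (hE : ∀ i, MeasurableSet (E i)) :
    ∫⁻ ω in {ω | (∀ i ∈ I, blockPath i (fun s => X (t + s) ω) ∈ D i) ∧
        ∀ i ∈ J, blockPath i (fun s => X (t + s) ω) ∈ E i}, G ω ∂(μ.bind P) =
      ∫⁻ ω in {ω | ∀ i ∈ J, blockPath i (fun s => X (t + s) ω) ∈ E i},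
        G ω * P (X t ω) {ω' | ∀ i ∈ I, blockPath i (fun s => X s ω') ∈ D i} ∂(μ.bind P) := by
  have h1 := hX.markov_lintegral μ t hG
    ((measurableSet_forall_blockPath I hD).inter (measurableSet_forall_blockPath J hE))
  have hXt : Measurable[naturalFiltration X hX.measurable t] (X t) := by
    have h : MeasurableSpace.comap (X t) inferInstance ≤ naturalFiltration X hX.measurable t :=
      le_iSup₂ (f := fun s (_ : s ≤ t) => MeasurableSpace.comap (X s) inferInstance) t le_rfl
    exact measurable_iff_comap_le.2 h
  -- The Markov property is used a second time, for `J` alone, with the probability concerning `I`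
  -- moved into the weight. Independence given `X t` then identifies the two integrands.
  have h2 := hX.markov_lintegral μ t (G := fun ω => G ω *
      P (X t ω) {ω' | ∀ i ∈ I, blockPath i (fun s => X s ω') ∈ D i})
    (hG.mul ((hX.measurable_prob_path (measurableSet_forall_blockPath I hD)).comp hXt))
    (measurableSet_forall_blockPath J hE)
  refine h1.trans (Eq.trans ?_ h2.symm)
  refine lintegral_congr fun ω => ?_
  by_cases h0 : G ω = 0
  · simp [h0]
  · rw [mul_assoc]
    congr 1
    exact hX.prob_blockPath_and (hIJ ω h0) hD hE

/-! ### Refinement of the partitions, frozen blocks, and absence of fixed discontinuities. -/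

lemma prob_rel_and_not_rel (hX : IsESSF α X P) (x : MarkedPartition) (t : ℝ≥0) (i j : ℕ) :
    P x {ω | (X t ω).rel.r i j ∧ ¬ x.rel.r i j} = 0 := by
  have hC : MeasurableSet {y : ℝ≥0 → MarkedPartition | (y t).rel.r i j ∧ ¬ x.rel.r i j} :=
    measurableSet_setOfPred.2
      (((measurable_rel i j).comp (measurable_pi_apply t)).and measurable_const)
  have h := hX.prob_eq_infinitePi x hC
  refine h.trans ?_
  convert measure_empty (μ := Measure.infinitePi fun _ : ℕ => P one)
  ext ω
  simp only [mem_ofPred_eq, mem_empty_iff_false, iff_false, not_and, not_not]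
  exact fun h => h.1

/-- The partitions are almost surely refined as time increases. -/
lemma ae_refines (hX : IsESSF α X P) (μ : Measure MarkedPartition) [IsProbabilityMeasure μ] :
    ∀ᵐ ω ∂(μ.bind P), ∀ s t, s ≤ t → ∀ i j, (X t ω).rel.r i j → (X s ω).rel.r i j := by
  have key : ∀ s t : ℝ≥0, ∀ i j, ∀ᵐ ω ∂(μ.bind P),
      (X (s + t) ω).rel.r i j → (X s ω).rel.r i j := by
    intro s t i j
    have hC : MeasurableSet {y : ℝ≥0 → MarkedPartition | (y t).rel.r i j ∧ ¬ (y 0).rel.r i j} :=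
      measurableSet_setOfPred.2 (((measurable_rel i j).comp (measurable_pi_apply t)).and
        ((measurable_rel i j).comp (measurable_pi_apply 0)).not)
    have h := hX.markov_bind μ s MeasurableSet.univ hC
    have h0 : ∀ x, P x {ω' | (fun s => X s ω') ∈
        {y : ℝ≥0 → MarkedPartition | (y t).rel.r i j ∧ ¬ (y 0).rel.r i j}} = 0 := by
      intro x
      refine (measure_congr ?_).trans (hX.prob_rel_and_not_rel x t i j)
      filter_upwards [hX.start x] with ω hω
      change ((X t ω).rel.r i j ∧ ¬ (X 0 ω).rel.r i j) = ((X t ω).rel.r i j ∧ ¬ x.rel.r i j)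
      rw [hω]
    simp only [h0, lintegral_zero, univ_inter] at h
    refine (measure_eq_zero_iff_ae_notMem.1 h).mono fun ω hω h1 => ?_
    by_contra h2
    refine hω ⟨h1, ?_⟩
    change ¬ (X (s + 0) ω).rel.r i j
    rwa [add_zero]
  have key' : ∀ᵐ ω ∂(μ.bind P), ∀ (n a b i j : ℕ),
      (X ((a : ℝ≥0) / (n + 1) + (b : ℝ≥0) / (n + 1)) ω).rel.r i j →
        (X ((a : ℝ≥0) / (n + 1)) ω).rel.r i j := by
    simp only [ae_all_iff]
    exact fun n a b i j => key _ _ i j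
  filter_upwards [key'] with ω hω s t hst i j
  have h1 := (hX.cadlag ω).tendsto_rel (i := i) (j := j) (tendsto_gridCeil s)
  have h2 := (hX.cadlag ω).tendsto_rel (i := i) (j := j) (tendsto_gridCeil t)
  -- A single mesh serves both times, so the two grid points differ by a multiple of `1 / (n + 1)`.
  obtain ⟨n, hn1, hn2⟩ := (h1.and h2).exists
  rw [← hn1, ← hn2]
  have hle : ⌈((n : ℝ≥0) + 1) * s⌉₊ ≤ ⌈((n : ℝ≥0) + 1) * t⌉₊ :=
    Nat.ceil_le_ceil (by gcongr)
  obtain ⟨b, hb⟩ := Nat.exists_eq_add_of_le hle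
  have := hω n ⌈((n : ℝ≥0) + 1) * s⌉₊ b i j
  rw [← add_div, ← Nat.cast_add, ← hb] at this
  exact this

/-- The convention `0 ^ α = 0` stops the clock for every `α`: the copy is read at time `0` only,
where it is `one` and leaves the block intact. -/
lemma prob_blockMark_ne_of_mark_eq_zero (hX : IsESSF α X P) {x : MarkedPartition} {i : ℕ}
    (hx : x.mark i = 0) (t : ℝ≥0) : P x {ω | blockMark i (X t ω) ≠ blockMark i x} = 0 := by
  have hs : MeasurableSet {b : Set ℕ × ℝ≥0 | b ≠ blockMark i x} :=
    (measurableSet_singleton _).compl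
  have hC : MeasurableSet {y : ℝ≥0 → MarkedPartition | blockMark i (y t) ≠ blockMark i x} :=
    ((measurable_blockMark i).comp (measurable_pi_apply t)) hs
  refine (hX.prob_eq_infinitePi x hC).trans ?_
  rw [measure_eq_zero_iff_ae_notMem]
  have h0 : ∀ᵐ ω ∂(Measure.infinitePi fun _ : ℕ => P one), X 0 (ω (x.label i)) = one :=
    (measurePreserving_eval_infinitePi (fun _ : ℕ => P one)
      (x.label i)).quasiMeasurePreserving.ae (hX.start one)
  filter_upwards [h0] with ω hω
  simp only [not_not]
  change scaledBlockPath α i (blockMark i x) (fun t => X t (ω (x.label i))) t = _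
  have : markPow (x.mark i) α * t = 0 := by simp [hx, markPow]
  simp only [scaledBlockPath, blockMark, this, hω]
  refine Prod.ext ?_ (by simp [hx])
  exact (inter_eq_left.2 fun j _ => trivial)

/-- Blocks of mark `0` are almost surely frozen. -/
lemma ae_blockMark_eq_of_mark_eq_zero (hX : IsESSF α X P) {x : MarkedPartition} {i : ℕ}
    (hx : x.mark i = 0) : ∀ᵐ ω ∂P x, ∀ t, blockMark i (X t ω) = blockMark i x := by
  have h : ∀ᵐ ω ∂P x, ∀ n k : ℕ, blockMark i (X ((k : ℝ≥0) / (n + 1)) ω) = blockMark i x := by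
    simp only [ae_all_iff]
    intro n k
    exact hX.prob_blockMark_ne_of_mark_eq_zero hx _
  filter_upwards [h] with ω hω t
  have := (hX.cadlag ω).blockMark_eq_of_forall_grid (s := 0) (fun n k => by
    rw [zero_add]; exact hω n k) t
  rwa [zero_add] at this

lemma blockFiltration_le (hX : IsESSF α X P) (i : ℕ) :
    blockFiltration X hX.measurable i ≤ naturalFiltration X hX.measurable := by
  intro t
  refine iSup₂_mono fun s _ => sup_le ?_ ?_
  · exact measurable_iff_comap_le.1 ((measurable_block i).comp (comap_measurable (X s)))
  · exact measurable_iff_comap_le.1 ((measurable_mark i).comp (comap_measurable (X s)))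

/-- A block whose mark is `0` at a stopping time is almost surely frozen from then on. -/
lemma ae_frozen_of_stoppingTime (hX : IsESSF α X P) (μ : Measure MarkedPartition)
    {τ : Ω → ℝ≥0∞} {i : ℕ}
    (hτ : IsStoppingTime (blockFiltration X hX.measurable i) τ) :
    ∀ᵐ ω ∂(μ.bind P), τ ω ≠ ∞ → (X (τ ω).toNNReal ω).mark i = 0 →
      ∀ t, blockMark i (X ((τ ω).toNNReal + t) ω) = blockMark i (X (τ ω).toNNReal ω) := by
  have hτ' : IsStoppingTime (naturalFiltration X hX.measurable) τ := fun t =>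
    hX.blockFiltration_le i t _ (hτ t)
  have key : ∀ t : ℝ≥0, ∀ᵐ ω ∂(μ.bind P), τ ω ≠ ∞ → (X (τ ω).toNNReal ω).mark i = 0 →
      blockMark i (X ((τ ω).toNNReal + t) ω) = blockMark i (X (τ ω).toNNReal ω) := by
    intro t
    have hb : ∀ s : ℝ≥0, Measurable fun y : ℝ≥0 → MarkedPartition => blockMark i (y s) :=
      fun s => (measurable_blockMark i).comp (measurable_pi_apply s)
    -- Starting with mark `0` and having changed at time `t` is a null event from every initial
    -- state; the strong Markov property carries this over to the path restarted at `τ`.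
    have hC : MeasurableSet {y : ℝ≥0 → MarkedPartition |
        (y 0).mark i = 0 ∧ blockMark i (y t) ≠ blockMark i (y 0)} := by
      refine MeasurableSet.inter (((measurable_mark i).comp (measurable_pi_apply 0))
        (measurableSet_singleton 0)) ?_
      exact (measurableSet_blockMark_eq (hb t) (hb 0)).compl
    have h := hX.strong_markov_bind μ hτ' MeasurableSet.univ hC
    have h0 : ∀ x, P x {ω' | (fun s => X s ω') ∈ {y : ℝ≥0 → MarkedPartition |
        (y 0).mark i = 0 ∧ blockMark i (y t) ≠ blockMark i (y 0)}} = 0 := by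
      intro x
      rw [measure_eq_zero_iff_ae_notMem]
      by_cases hx : x.mark i = 0
      · filter_upwards [hX.start x, hX.ae_blockMark_eq_of_mark_eq_zero hx] with ω h1 h2 h3
        exact h3.2 ((h2 t).trans (h2 0).symm)
      · filter_upwards [hX.start x] with ω h1 h3
        exact hx (h1 ▸ h3.1)
    simp only [h0, lintegral_zero, univ_inter] at h
    refine (measure_eq_zero_iff_ae_notMem.1 h).mono fun ω hω h1 h2 => ?_
    by_contra h3
    exact hω ⟨lt_top_iff_ne_top.2 h1, by simpa using h2, by simpa using h3⟩
  have key' : ∀ᵐ ω ∂(μ.bind P), ∀ n k : ℕ, τ ω ≠ ∞ → (X (τ ω).toNNReal ω).mark i = 0 →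
      blockMark i (X ((τ ω).toNNReal + (k : ℝ≥0) / (n + 1)) ω) =
        blockMark i (X (τ ω).toNNReal ω) := by
    simp only [ae_all_iff]
    exact fun n k => key _
  filter_upwards [key'] with ω hω h1 h2 t
  exact (hX.cadlag ω).blockMark_eq_of_forall_grid (fun n k => hω n k h1 h2) t

/-- There are no fixed times of discontinuity. -/
lemma ae_continuousAt_coord (hX : IsESSF α X P) (x : MarkedPartition) (t : ℝ≥0) (c : Coord) :
    ∀ᵐ ω ∂P x, ContinuousAt (fun s => coord c (X s ω)) t := by
  rcases eq_or_ne t 0 with rfl | ht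
  · refine Eventually.of_forall fun ω => ?_
    have h := (hX.cadlag ω).tendsto_coord c 0
    have : (Ici (0 : ℝ≥0)) = univ := by ext; simp
    rwa [this, nhdsWithin_univ] at h
  have hne : (𝓝[<] t).NeBot := by
    have : (Iio t).Nonempty := ⟨0, pos_iff_ne_zero.2 ht⟩
    exact nhdsLT_neBot_of_exists_lt ⟨0, pos_iff_ne_zero.2 ht⟩
  -- Along a sequence increasing the time to `t` from the left, the coordinates converge in
  -- probability both to the left limit, by pathwise convergence, and to the value at `t`, by
  -- stochastic continuity. The two limits therefore agree almost surely.
  choose l hl using fun ω => (hX.cadlag ω).exists_tendsto_coord c t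
  obtain ⟨u, hu⟩ := exists_seq_tendsto (𝓝[<] t)
  have hmeas : ∀ s, Measurable fun ω => coord c (X s ω) := fun s =>
    (measurable_coord c).comp (hX.measurable s)
  have h1 : TendstoInMeasure (P x) (fun n ω => coord c (X (u n) ω)) atTop l :=
    tendstoInMeasure_of_tendsto_ae (fun n => (hmeas _).aestronglyMeasurable)
      (Eventually.of_forall fun ω => (hl ω).comp hu)
  have h2 : TendstoInMeasure (P x) (fun n ω => coord c (X (u n) ω)) atTop
      (fun ω => coord c (X t ω)) := by
    rw [tendstoInMeasure_iff_dist]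
    intro ε hε
    have hU : IsOpen {p : MarkedPartition × MarkedPartition |
        dist (coord c p.1) (coord c p.2) < ε} :=
      isOpen_lt (((continuous_coord c).comp continuous_fst).dist
        ((continuous_coord c).comp continuous_snd)) continuous_const
    have h := (hX.stochastically_continuous x t _ hU (fun y => by simpa using hε)).comp
      (hu.mono_right nhdsWithin_le_nhds)
    refine h.congr fun n => ?_
    simp [Function.comp]
  filter_upwards [tendstoInMeasure_ae_unique h1 h2] with ω hω
  have h := hl ω
  rw [hω] at h
  rw [ContinuousAt, ← nhdsLT_sup_nhdsGE t, tendsto_sup]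
  exact ⟨h, (hX.cadlag ω).tendsto_coord c t⟩

end IsESSF

/-! ### The Markov property along deterministic lines -/

/-- Along the deterministic line `l`, the integers of `J` that are stopped at distinct times have
been separated before. -/
def SeparatedAlong (x : ℝ≥0 → MarkedPartition) (J : Finset ℕ) (l : ℕ → ℝ≥0∞) : Prop :=
  ∀ i ∈ J, ∀ j ∈ J, l i < l j → ¬ (x (l i).toNNReal).rel.r i j

/-- The `σ`-algebra generated by the blocks and marks of the integers `i ∈ J` up to the times
`l i`. -/
@[reducible]
def linePast {Ω : Type*} (X : ℝ≥0 → Ω → MarkedPartition) (J : Finset ℕ) (l : ℕ → ℝ≥0∞) :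
    MeasurableSpace Ω :=
  ⨆ p ∈ {p : ℕ × ℝ≥0 | p.1 ∈ J ∧ (p.2 : ℝ≥0∞) ≤ l p.1},
    MeasurableSpace.comap (fun ω => blockMark p.1 (X p.2 ω)) inferInstance

lemma measurable_forall_mem_finset {ι β : Type*} {m : MeasurableSpace β} (S : Finset ι)
    {p : ι → β → Prop} (h : ∀ i ∈ S, Measurable (p i)) : Measurable fun b => ∀ i ∈ S, p i b := by
  refine measurableSet_setOfPred.1 ?_
  simp only [ofPred_forall]
  exact S.measurableSet_biInter fun i hi => measurableSet_setOfPred.2 (h i hi)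

lemma measurableSet_cylinder {β : Type*} {m : MeasurableSpace β} {X : ℝ≥0 → β → MarkedPartition}
    {S : Finset (ℕ × ℝ≥0)} {e : ℕ × ℝ≥0 → Set (Set ℕ × ℝ≥0)} (he : ∀ p ∈ S, MeasurableSet (e p))
    {t : ℝ≥0} (h : ∀ p ∈ S, p.2 ≤ t → Measurable (X p.2)) :
    MeasurableSet {ω | ∀ p ∈ S, p.2 ≤ t → blockMark p.1 (X p.2 ω) ∈ e p} := by
  refine measurableSet_setOfPred.2 (measurable_forall_mem_finset S fun p hp => ?_)
  by_cases hpt : p.2 ≤ t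
  · simp only [hpt, true_imp_iff]
    exact measurableSet_setOfPred.1 (((measurable_blockMark p.1).comp (h p hp hpt)) (he p hp))
  · simp only [hpt, false_imp_iff]
    exact measurable_const

lemma measurableSet_separatedAlong {β : Type*} {m : MeasurableSpace β}
    {X : ℝ≥0 → β → MarkedPartition} {J : Finset ℕ} {l : ℕ → ℝ≥0∞} {t : ℝ≥0∞}
    (h : ∀ i ∈ J, l i ≤ t → l i ≠ ∞ → Measurable (X (l i).toNNReal)) :
    MeasurableSet {ω | ∀ i ∈ J, ∀ j ∈ J, l i ≤ t → l i < l j →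
      ¬ (X (l i).toNNReal ω).rel.r i j} := by
  simp only [ofPred_forall]
  refine J.measurableSet_biInter fun i hi => J.measurableSet_biInter fun j _ =>
    .iInter fun h1 => .iInter fun h2 => ?_
  exact measurableSet_setOfPred.2
    ((measurable_rel i j).comp (h i hi h1 (h2.trans_le le_top).ne)).not

namespace IsESSF

variable {Ω : Type*} [MeasurableSpace Ω] {α : ℝ} {X : ℝ≥0 → Ω → MarkedPartition}
  {P : Kernel MarkedPartition Ω} [IsMarkovKernel P]

lemma measurable_of_le (hX : IsESSF α X P) {s t : ℝ≥0} (hst : s ≤ t) :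
    Measurable[naturalFiltration X hX.measurable t] (X s) := by
  have h : MeasurableSpace.comap (X s) inferInstance ≤ naturalFiltration X hX.measurable t :=
    le_iSup₂ (f := fun s (_ : s ≤ t) => MeasurableSpace.comap (X s) inferInstance) s hst
  exact measurable_iff_comap_le.2 h

/-- Induction on `V`, removing the smallest time `t₀`. Events up to `t₀` belong to the past;
everything later concerns integers with `t₀ < l i`, whose blocks are separated from those with `l i
= t₀`. The conditional probability for the latter is a function of the past of `t₀`, so it joins the
weight `G`, and for this reason the statement holds for all `G`. -/
lemma lintegral_line_cylinder (hX : IsESSF α X P) (μ : Measure MarkedPartition)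
    [IsProbabilityMeasure μ] {J : Finset ℕ} {l : ℕ → ℝ≥0∞} {D : ℕ → Set (ℝ≥0 → Set ℕ × ℝ≥0)}
    (hD : ∀ i, MeasurableSet (D i)) {S : Finset (ℕ × ℝ≥0)}
    (hS : ∀ p ∈ S, p.1 ∈ J ∧ (p.2 : ℝ≥0∞) ≤ l p.1) {e : ℕ × ℝ≥0 → Set (Set ℕ × ℝ≥0)}
    (he : ∀ p ∈ S, MeasurableSet (e p)) (V : Finset ℝ≥0) : ∀ G : Ω → ℝ≥0∞,
    (∀ t ∈ V, Measurable[naturalFiltration X hX.measurable t] G) →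
    ∫⁻ ω in {ω | (∀ p ∈ S, blockMark p.1 (X p.2 ω) ∈ e p) ∧
        SeparatedAlong (fun t => X t ω) J l ∧
        ∀ t ∈ V, ∀ i ∈ J.filter (l · = (t : ℝ≥0∞)), blockPath i (fun s => X (t + s) ω) ∈ D i},
      G ω ∂(μ.bind P) =
    ∫⁻ ω in {ω | (∀ p ∈ S, blockMark p.1 (X p.2 ω) ∈ e p) ∧
        SeparatedAlong (fun t => X t ω) J l},
      G ω * ∏ t ∈ V, P (X t ω) {ω' | ∀ i ∈ J.filter (l · = (t : ℝ≥0∞)),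
        blockPath i (fun s => X s ω') ∈ D i} ∂(μ.bind P) := by
  induction V using Finset.induction_on_min with
  | empty => intro G _; simp
  | insert t₀ V hV ih =>
    intro G hG
    let past : Set Ω := {ω | (∀ p ∈ S, p.2 ≤ t₀ → blockMark p.1 (X p.2 ω) ∈ e p) ∧
      ∀ i ∈ J, ∀ j ∈ J, l i ≤ t₀ → l i < l j → ¬ (X (l i).toNNReal ω).rel.r i j}
    -- The constraints after `t₀`, sorted by integer and expressed on the path shifted by `t₀`: the
    -- rest of the cylinder, the later separations and the later restarts.
    let E : ℕ → Set (ℝ≥0 → Set ℕ × ℝ≥0) := fun i => {w |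
      (∀ p ∈ S, p.1 = i → t₀ < p.2 → w (p.2 - t₀) ∈ e p) ∧
      (∀ j ∈ J, l i < l j → j ∉ (w ((l i).toNNReal - t₀)).1) ∧
      ∀ t ∈ V, l i = t → (fun s => w (t - t₀ + s)) ∈ D i}
    have hpast : MeasurableSet[naturalFiltration X hX.measurable t₀] past := by
      refine MeasurableSet.inter (measurableSet_cylinder he fun p _ h => hX.measurable_of_le h)
        (measurableSet_separatedAlong fun i _ h _ => hX.measurable_of_le ?_)
      simpa using ENNReal.toNNReal_mono ENNReal.coe_ne_top h
    have hE : ∀ i, MeasurableSet (E i) := by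
      intro i
      refine measurableSet_setOfPred.2 (.and ?_ (.and ?_ ?_))
      · refine measurable_forall_mem_finset S fun p hp => .imp measurable_const
          (.imp measurable_const (measurableSet_setOfPred.1 ?_))
        exact measurable_pi_apply _ (he p hp)
      · refine measurable_forall_mem_finset J fun j _ => .imp measurable_const (.not ?_)
        exact measurable_set_iff.1 (measurable_pi_apply ((l i).toNNReal - t₀)).fst j
      · refine measurable_forall_mem_finset V fun t _ => .imp measurable_const
          (measurableSet_setOfPred.1 ?_)
        exact (measurable_pi_lambda _ fun s => measurable_pi_apply (t - t₀ + s)) (hD i)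
    have hsplit : ∀ ω, (ω ∈ past ∧ ∀ i ∈ J.filter ((t₀ : ℝ≥0∞) < l ·),
          blockPath i (fun s => X (t₀ + s) ω) ∈ E i) ↔
        ((∀ p ∈ S, blockMark p.1 (X p.2 ω) ∈ e p) ∧ SeparatedAlong (fun t => X t ω) J l ∧
          ∀ t ∈ V, ∀ i ∈ J.filter (l · = (t : ℝ≥0∞)),
            blockPath i (fun s => X (t + s) ω) ∈ D i) := by
      intro ω
      have hadd : ∀ {t : ℝ≥0}, t₀ ≤ t → t₀ + (t - t₀) = t := add_tsub_cancel_of_le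
      have hb : ∀ i (t : ℝ≥0), t₀ ≤ t →
          blockPath i (fun s => X (t₀ + s) ω) (t - t₀) = blockMark i (X t ω) := fun i t ht => by
        simp only [blockPath, hadd ht]
      have hb' : ∀ i (t : ℝ≥0), t₀ ≤ t →
          (fun s => blockPath i (fun s => X (t₀ + s) ω) (t - t₀ + s)) =
            blockPath i (fun s => X (t + s) ω) := fun i t ht => by
        funext s
        simp only [blockPath, ← add_assoc, hadd ht]
      have hle : ∀ i, (t₀ : ℝ≥0∞) < l i → l i ≠ ∞ → t₀ ≤ (l i).toNNReal := fun i h h' => by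
        rw [← ENNReal.coe_le_coe, ENNReal.coe_toNNReal h']
        exact h.le
      constructor
      · rintro ⟨⟨h1, h2⟩, h3⟩
        refine ⟨fun p hp => ?_, fun i hi j hj hij => ?_, fun t ht i hi => ?_⟩
        · rcases le_or_gt p.2 t₀ with h | h
          · exact h1 p hp h
          · have := (h3 p.1 (Finset.mem_filter.2 ⟨(hS p hp).1,
              (ENNReal.coe_lt_coe.2 h).trans_le (hS p hp).2⟩)).1 p hp rfl h
            rwa [hb _ _ h.le] at this
        · rcases le_or_gt (l i) t₀ with h | h
          · exact h2 i hi j hj h hij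
          · have := (h3 i (Finset.mem_filter.2 ⟨hi, h⟩)).2.1 j hj hij
            rwa [hb _ _ (hle i h (hij.trans_le le_top).ne)] at this
        · rw [Finset.mem_filter] at hi
          have := (h3 i (Finset.mem_filter.2
            ⟨hi.1, hi.2 ▸ ENNReal.coe_lt_coe.2 (hV t ht)⟩)).2.2 t ht hi.2
          rwa [hb' _ _ (hV t ht).le] at this
      · rintro ⟨h1, h2, h3⟩
        refine ⟨⟨fun p hp _ => h1 p hp, fun i hi j hj _ => h2 i hi j hj⟩, fun i hi => ?_⟩
        rw [Finset.mem_filter] at hi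
        refine ⟨fun p hp hpi h => ?_, fun j hj hij => ?_, fun t ht hit => ?_⟩
        · rw [hb _ _ h.le, ← hpi]
          exact h1 p hp
        · rw [hb _ _ (hle i hi.2 (hij.trans_le le_top).ne)]
          exact h2 i hi.1 j hj hij
        · rw [hb' _ _ (hV t ht).le]
          exact h3 t ht i (Finset.mem_filter.2 ⟨hi.1, hit⟩)
    have hGt := hG t₀ (Finset.mem_insert_self _ _)
    have hpast' := (naturalFiltration X hX.measurable).le t₀ _ hpast
    -- The indicator of `past` in the weight supplies the separation of the two groups of blocks.
    have hmk := hX.markov_blocks μ t₀ (G := past.indicator G) (hGt.indicator hpast)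
      (I := J.filter (l · = (t₀ : ℝ≥0∞))) (J := J.filter ((t₀ : ℝ≥0∞) < l ·)) (D := D) (E := E)
      (by
        intro ω hω i hi j hj
        have hω' : ω ∈ past := by
          by_contra h
          exact hω (indicator_of_notMem h _)
        rw [Finset.mem_filter] at hi hj
        have := hω'.2 i hi.1 j hj.1 hi.2.le (hi.2 ▸ hj.2)
        rwa [hi.2, ENNReal.toNNReal_coe] at this) hD hE
    have hφ : Measurable[naturalFiltration X hX.measurable t₀] fun ω =>
        P (X t₀ ω) {ω' | ∀ i ∈ J.filter (l · = (t₀ : ℝ≥0∞)),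
          blockPath i (fun s => X s ω') ∈ D i} :=
      (hX.measurable_prob_path (measurableSet_forall_blockPath _ hD)).comp
        (hX.measurable_of_le le_rfl)
    have hIH := ih (fun ω => G ω * P (X t₀ ω) {ω' | ∀ i ∈ J.filter (l · = (t₀ : ℝ≥0∞)),
          blockPath i (fun s => X s ω') ∈ D i}) fun t ht =>
      (hG t (Finset.mem_insert_of_mem ht)).mul
        (hφ.mono ((naturalFiltration X hX.measurable).mono (hV t ht).le) le_rfl)
    have hmul : ∀ ω, past.indicator G ω * P (X t₀ ω) {ω' | ∀ i ∈ J.filter (l · = (t₀ : ℝ≥0∞)),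
          blockPath i (fun s => X s ω') ∈ D i} = past.indicator (fun ω => G ω *
        P (X t₀ ω) {ω' | ∀ i ∈ J.filter (l · = (t₀ : ℝ≥0∞)),
          blockPath i (fun s => X s ω') ∈ D i}) ω := fun ω => by
      by_cases h : ω ∈ past <;> simp [h]
    rw [lintegral_congr hmul, setLIntegral_indicator hpast', setLIntegral_indicator hpast'] at hmk
    have hnot : t₀ ∉ V := fun h => lt_irrefl _ (hV _ h)
    calc _ = _ := by
          congr 2
          ext ω
          constructor
          · rintro ⟨h1, h2, h3⟩
            obtain ⟨ha, hb⟩ := (hsplit ω).2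
              ⟨h1, h2, fun t ht => h3 t (Finset.mem_insert_of_mem ht)⟩
            exact ⟨ha, h3 t₀ (Finset.mem_insert_self _ _), hb⟩
          · rintro ⟨ha, hc, hb⟩
            obtain ⟨h1, h2, h3⟩ := (hsplit ω).1 ⟨ha, hb⟩
            exact ⟨h1, h2, (Finset.forall_mem_insert _ _ _).2 ⟨hc, h3⟩⟩
      _ = _ := hmk
      _ = _ := by
          congr 2
          ext ω
          exact hsplit ω
      _ = _ := hIH
      _ = _ := by
          refine lintegral_congr fun ω => ?_
          rw [Finset.prod_insert hnot, mul_assoc]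

/-- The Markov property along a deterministic line `l`, on the event that the line is compatible
with the fragmentation. -/
lemma prob_line (hX : IsESSF α X P) (μ : Measure MarkedPartition)
    [IsProbabilityMeasure μ] {J : Finset ℕ} {l : ℕ → ℝ≥0∞} {D : ℕ → Set (ℝ≥0 → Set ℕ × ℝ≥0)}
    (hD : ∀ i, MeasurableSet (D i)) (V : Finset ℝ≥0) {A : Set Ω}
    (hA : MeasurableSet[linePast X J l] A) :
    μ.bind P (A ∩ {ω | SeparatedAlong (fun t => X t ω) J l ∧
        ∀ t ∈ V, ∀ i ∈ J.filter (l · = (t : ℝ≥0∞)), blockPath i (fun s => X (t + s) ω) ∈ D i}) =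
    ∫⁻ ω in A ∩ {ω | SeparatedAlong (fun t => X t ω) J l},
      ∏ t ∈ V, P (X t ω) {ω' | ∀ i ∈ J.filter (l · = (t : ℝ≥0∞)),
        blockPath i (fun s => X s ω') ∈ D i} ∂(μ.bind P) := by
  set Q := μ.bind P
  have hle : linePast X J l ≤ (inferInstance : MeasurableSpace Ω) :=
    iSup₂_le fun p _ => ((measurable_blockMark p.1).comp (hX.measurable p.2)).comap_le
  have hN : MeasurableSet {ω | SeparatedAlong (fun t => X t ω) J l} := by
    have := measurableSet_separatedAlong (X := X) (J := J) (l := l) (t := ∞)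
      fun i _ _ _ => hX.measurable _
    simpa [SeparatedAlong] using this
  let φ : Ω → ℝ≥0∞ := fun ω => ∏ t ∈ V, P (X t ω) {ω' | ∀ i ∈ J.filter (l · = (t : ℝ≥0∞)),
        blockPath i (fun s => X s ω') ∈ D i}
  -- Both sides, as functions of `A`, are measures; they agree on the cylinders generating
  -- `linePast` and have the same total mass, given by the empty cylinder.
  let ν := Q.restrict {ω | SeparatedAlong (fun t => X t ω) J l ∧
    ∀ t ∈ V, ∀ i ∈ J.filter (l · = (t : ℝ≥0∞)), blockPath i (fun s => X (t + s) ω) ∈ D i}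
  let ν' := (Q.restrict {ω | SeparatedAlong (fun t => X t ω) J l}).withDensity φ
  have hν : ∀ B, MeasurableSet B → ν B = Q (B ∩ {ω | SeparatedAlong (fun t => X t ω) J l ∧
        ∀ t ∈ V, ∀ i ∈ J.filter (l · = (t : ℝ≥0∞)), blockPath i (fun s => X (t + s) ω) ∈ D i}) :=
    fun B hB => Measure.restrict_apply hB
  have hν' : ∀ B, MeasurableSet B →
      ν' B = ∫⁻ ω in B ∩ {ω | SeparatedAlong (fun t => X t ω) J l}, φ ω ∂Q := fun B hB => by
    rw [withDensity_apply _ hB, Measure.restrict_restrict hB]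
  have hcyl : ∀ B ∈ piiUnionInter (fun p : ℕ × ℝ≥0 => {s | MeasurableSet[MeasurableSpace.comap
      (fun ω => blockMark p.1 (X p.2 ω)) inferInstance] s})
      {p : ℕ × ℝ≥0 | p.1 ∈ J ∧ (p.2 : ℝ≥0∞) ≤ l p.1}, MeasurableSet B ∧ ν B = ν' B := by
    rintro B ⟨S, hS, f, hf, rfl⟩
    choose! e he hfe using hf
    have hB : (⋂ p ∈ S, f p) = {ω | ∀ p ∈ S, blockMark p.1 (X p.2 ω) ∈ e p} := by
      ext ω
      simp only [mem_iInter, mem_ofPred_eq]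
      refine forall₂_congr fun p hp => ?_
      rw [← hfe p hp]
      rfl
    have hBm : MeasurableSet (⋂ p ∈ S, f p) := S.measurableSet_biInter fun p hp => by
      rw [← hfe p hp]
      exact ((measurable_blockMark p.1).comp (hX.measurable p.2)) (he p hp)
    refine ⟨hBm, ?_⟩
    rw [hν _ hBm, hν' _ hBm, hB]
    have h := hX.lintegral_line_cylinder μ hD (fun p hp => hS hp) he V 1
      (fun _ _ => measurable_const)
    simp only [Pi.one_apply, lintegral_one, one_mul, Measure.restrict_apply MeasurableSet.univ,
      univ_inter] at h
    exact h
  have huniv : ν univ = ν' univ := (hcyl univ ⟨∅, by simp, fun _ => univ, by simp, by simp⟩).2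
  have hgen := generateFrom_piiUnionInter_measurableSet (fun p : ℕ × ℝ≥0 =>
    MeasurableSpace.comap (fun ω => blockMark p.1 (X p.2 ω)) inferInstance)
    {p : ℕ × ℝ≥0 | p.1 ∈ J ∧ (p.2 : ℝ≥0∞) ≤ l p.1}
  have hpi := isPiSystem_piiUnionInter (fun p : ℕ × ℝ≥0 => {s | MeasurableSet[MeasurableSpace.comap
      (fun ω => blockMark p.1 (X p.2 ω)) inferInstance] s}) (fun p =>
        @MeasurableSpace.isPiSystem_measurableSet _ (MeasurableSpace.comap
          (fun ω => blockMark p.1 (X p.2 ω)) inferInstance))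
      {p : ℕ × ℝ≥0 | p.1 ∈ J ∧ (p.2 : ℝ≥0∞) ≤ l p.1}
  have hfin : IsFiniteMeasure ν := inferInstance
  have htrim : ν.trim hle = ν'.trim hle := by
    refine ext_of_generate_finite _ hgen.symm hpi (fun B hB => ?_) ?_
    · have hBm : MeasurableSet[linePast X J l] B := by
        unfold linePast
        rw [← hgen]
        exact MeasurableSpace.measurableSet_generateFrom hB
      rw [trim_measurableSet_eq hle hBm, trim_measurableSet_eq hle hBm]
      exact (hcyl B hB).2
    · rw [trim_measurableSet_eq hle .univ, trim_measurableSet_eq hle .univ]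
      exact huniv
  rw [← hν A (hle _ hA), ← hν' A (hle _ hA), ← trim_measurableSet_eq hle hA, htrim,
    trim_measurableSet_eq hle hA]

end IsESSF

/-! ### The Markov property along discrete stopping lines -/

lemma atTime_coe (x : ℝ≥0 → MarkedPartition) (t : ℝ≥0) : atTime x t = x t := by simp [atTime]

lemma atTime_top (x : ℝ≥0 → MarkedPartition) : atTime x ∞ = atInfinity x := by simp [atTime]

/-- Along a line that is constant on its blocks, blocks are read from the path. -/
lemma blockMark_alongLine_add {x : ℝ≥0 → MarkedPartition}
    (hx : ∀ s t, s ≤ t → ∀ i j, (x t).rel.r i j → (x s).rel.r i j) {l : ℕ → ℝ≥0∞}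
    (hl : ∀ i j, (atTime x (l i)).rel.r i j → l i = l j) (i : ℕ) (t : ℝ≥0) :
    blockMark i (alongLine x fun j => l j + t) = blockMark i (atTime x (l i + t)) := by
  refine Prod.ext ?_ rfl
  ext j
  change (l i + t = l j + t ∧ (atTime x (l i + t)).rel.r i j) ↔ (atTime x (l i + t)).rel.r i j
  refine and_iff_right_of_imp fun h => ?_
  rw [hl i j]
  rcases eq_or_ne (l i) ∞ with h' | h'
  · rw [h', top_add] at h
    rwa [h']
  · lift l i to ℝ≥0 using h' with a ha
    rw [← ha, ← ENNReal.coe_add, atTime_coe] at h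
    rw [← ha, atTime_coe]
    exact hx a (a + t) le_self_add i j h

lemma blockMark_alongLine {x : ℝ≥0 → MarkedPartition} {l : ℕ → ℝ≥0∞}
    (hl : ∀ i j, (atTime x (l i)).rel.r i j → l i = l j) (i : ℕ) :
    blockMark i (alongLine x l) = blockMark i (atTime x (l i)) :=
  Prod.ext (by ext j; exact and_iff_right_of_imp fun h => hl i j h) rfl

/-- The sets of paths that prescribe the evolution of finitely many blocks. -/
def blockCylinders : Set (Set (ℝ≥0 → MarkedPartition)) :=
  {C | ∃ (J : Finset ℕ) (D : ℕ → Set (ℝ≥0 → Set ℕ × ℝ≥0)), (∀ i, MeasurableSet (D i)) ∧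
    C = {x | ∀ i ∈ J, blockPath i x ∈ D i}}

lemma isPiSystem_blockCylinders : IsPiSystem blockCylinders := by
  classical
  rintro _ ⟨I, D, hD, rfl⟩ _ ⟨J, E, hE, rfl⟩ -
  refine ⟨I ∪ J, fun i => (if i ∈ I then D i else univ) ∩ (if i ∈ J then E i else univ),
    fun i => ?_, ?_⟩
  · refine MeasurableSet.inter ?_ ?_ <;> split_ifs <;> simp [hD, hE]
  · ext x
    simp only [mem_inter_iff, mem_ofPred_eq, Finset.mem_union]
    constructor
    · rintro ⟨h1, h2⟩ i -
      constructor <;> split_ifs with h <;> simp_all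
    · intro h
      refine ⟨fun i hi => ?_, fun i hi => ?_⟩
      · simpa [hi] using (h i (Or.inl hi)).1
      · simpa [hi] using (h i (Or.inr hi)).2

lemma generateFrom_blockCylinders :
    (MeasurableSpace.pi : MeasurableSpace (ℝ≥0 → MarkedPartition)) =
      MeasurableSpace.generateFrom blockCylinders := by
  refine le_antisymm (iSup_le fun t => ?_) (MeasurableSpace.generateFrom_le ?_)
  · refine measurable_iff_comap_le.1 (measurable_of_rel_mark (fun i j => ?_) fun i s hs => ?_)
    · refine MeasurableSpace.measurableSet_generateFrom
        ⟨{i}, fun _ => {w | j ∈ (w t).1}, fun _ => ?_, by simp [blockPath, blockMark, block]⟩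
      exact measurableSet_setOfPred.2 (measurable_set_iff.1 (measurable_pi_apply t).fst j)
    · refine MeasurableSpace.measurableSet_generateFrom
        ⟨{i}, fun _ => {w | (w t).2 ∈ s}, fun _ => ?_, ?_⟩
      · exact (measurable_pi_apply t).snd hs
      · ext x
        simp [blockPath, blockMark]
  · rintro _ ⟨J, D, hD, rfl⟩
    exact measurableSet_forall_blockPath J hD

/-- A coordinate sees the line only on its support, so a random line may be replaced by a
deterministic one on the event that they agree on `J`. -/
lemma coord_alongLine_congr {x : ℝ≥0 → MarkedPartition} {J : Finset ℕ} {l l' : ℕ → ℝ≥0∞}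
    (h : ∀ i ∈ J, l i = l' i) {c : Coord} (hc : c.support ⊆ J) :
    coord c (alongLine x l) = coord c (alongLine x l') := by
  rcases c with ⟨i, j⟩ | i | i
  · have hi : l i = l' i := h i (hc (by simp [Coord.support]))
    have hj : l j = l' j := h j (hc (by simp [Coord.support]))
    have : (alongLine x l).rel.r i j ↔ (alongLine x l').rel.r i j := by
      change (l i = l j ∧ (atTime x (l i)).rel.r i j) ↔ (l' i = l' j ∧ (atTime x (l' i)).rel.r i j)
      rw [hi, hj]
    classical
    exact if_congr this rfl rfl
  · have hi : l i = l' i := h i (hc (by simp [Coord.support]))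
    simp only [coord, alongLine, hi]
  · have hi : l i = l' i := h i (hc (by simp [Coord.support]))
    simp only [coord, alongLine, hi]

/-! ### Measurability with respect to the past of a deterministic line. -/

section LinePast

variable {Ω : Type*} {X : ℝ≥0 → Ω → MarkedPartition}

lemma linePast_singleton_le {J : Finset ℕ} {l : ℕ → ℝ≥0∞} {i : ℕ} (hi : i ∈ J) :
    linePast X {i} (fun _ => l i) ≤ linePast X J l := by
  refine biSup_mono fun p hp => ?_
  obtain ⟨h1, h2⟩ := hp
  rw [Finset.mem_singleton] at h1
  exact ⟨h1 ▸ hi, h1 ▸ h2⟩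

lemma measurable_blockMark_linePast {J : Finset ℕ} {l : ℕ → ℝ≥0∞} {i : ℕ} (hi : i ∈ J) {s : ℝ≥0}
    (hs : (s : ℝ≥0∞) ≤ l i) : Measurable[linePast X J l] fun ω => blockMark i (X s ω) :=
  measurable_iff_comap_le.2 (le_iSup₂ (f := fun (p : ℕ × ℝ≥0)
    (_ : p ∈ {p : ℕ × ℝ≥0 | p.1 ∈ J ∧ (p.2 : ℝ≥0∞) ≤ l p.1}) =>
    MeasurableSpace.comap (fun ω => blockMark p.1 (X p.2 ω)) inferInstance) (i, s) ⟨hi, hs⟩)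

lemma measurable_rel_of_blockMark {β : Type*} {m : MeasurableSpace β} {f : β → MarkedPartition}
    {i : ℕ} (h : Measurable fun b => blockMark i (f b)) (j : ℕ) :
    Measurable fun b => (f b).rel.r i j :=
  measurable_set_iff.1 h.fst j

/-- Times capped by `l i` never read a block beyond the line, and whether two line times agree is
not random. -/
lemma measurable_coord_linePast {J : Finset ℕ} {l : ℕ → ℝ≥0∞} {c : Coord} (hc : c.support ⊆ J)
    (t : ℝ≥0) : Measurable[linePast X J l] fun ω =>
      coord c (alongLine (fun t => X t ω) fun i => min (l i) t) := by
  let _ := linePast X J l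
  have key : ∀ i ∈ J, Measurable fun ω =>
      blockMark i (atTime (fun t => X t ω) (min (l i) t)) := by
    intro i hi
    have hne : min (l i) t ≠ ∞ := (min_lt_of_right_lt ENNReal.coe_lt_top).ne
    lift min (l i) t to ℝ≥0 using hne with s hs
    simp only [atTime_coe]
    exact measurable_blockMark_linePast hi (hs ▸ min_le_left _ _)
  rcases c with ⟨i, j⟩ | i | i
  · have hi : i ∈ J := hc (by simp [Coord.support])
    refine Measurable.ite (measurableSet_setOfPred.2 ?_) measurable_const measurable_const
    exact measurable_const.and (measurable_rel_of_blockMark (key i hi) j)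
  · have hi : i ∈ J := hc (by simp [Coord.support])
    exact continuous_circleFst.measurable.comp (key i hi).snd
  · have hi : i ∈ J := hc (by simp [Coord.support])
    exact continuous_circleSnd.measurable.comp (key i hi).snd

lemma measurable_coords_linePast {J : Finset ℕ} {l : ℕ → ℝ≥0∞} {K : Finset (Coord × ℝ≥0)}
    (hK : ∀ k ∈ K, k.1.support ⊆ J) : Measurable[linePast X J l] fun ω (k : K) =>
      coord k.1.1 (alongLine (fun t => X t ω) fun i => min (l i) k.1.2) := by
  let _ := linePast X J l
  exact measurable_pi_lambda _ fun k => measurable_coord_linePast (hK k.1 k.2) _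

/-- When `l i = ∞`, the whole path of the block of `i` belongs to the past, and with it the limit.
-/
lemma measurable_atInfinity_linePast (hc : ∀ ω, IsCadlag fun t => X t ω) {J : Finset ℕ}
    {l : ℕ → ℝ≥0∞} {i : ℕ} (hi : i ∈ J) (hl : l i = ∞) :
    Measurable[linePast X J l] fun ω => blockMark i (atInfinity fun t => X t ω) := by
  let _ := linePast X J l
  refine Measurable.prodMk (measurable_set_iff.2 fun j => ?_) measurable_const
  change Measurable fun ω => (atInfinity fun t => X t ω).rel.r i j
  simp_rw [fun ω => atInfinity_rel_iff (hc ω) i j]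
  refine Measurable.exists fun N => .forall fun n => .forall fun k => .imp measurable_const ?_
  exact measurable_rel_of_blockMark (measurable_blockMark_linePast hi (by simp [hl])) j

lemma measurableSet_frozen (hc : ∀ ω, IsCadlag fun t => X t ω) {J : Finset ℕ} {l : ℕ → ℝ≥0∞}
    {D : ℕ → Set (ℝ≥0 → Set ℕ × ℝ≥0)} (hD : ∀ i, MeasurableSet (D i)) :
    MeasurableSet[linePast X J l] {ω | ∀ i ∈ J, l i = ∞ →
      (fun _ : ℝ≥0 => blockMark i (atInfinity fun t => X t ω)) ∈ D i} := by
  let _ := linePast X J l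
  refine measurableSet_setOfPred.2 (measurable_forall_mem_finset J fun i hi => ?_)
  by_cases h : l i = ∞
  · simp only [h, true_imp_iff]
    exact measurableSet_setOfPred.1 ((measurable_pi_lambda (fun ω (_ : ℝ≥0) =>
      blockMark i (atInfinity fun t => X t ω)) fun _ =>
        measurable_atInfinity_linePast hc hi h) (hD i))
  · simp only [h, false_imp_iff]
    exact measurable_const

end LinePast

/-- A stopping line with values in a countable set. -/
structure IsDiscreteLine {Ω : Type*} [MeasurableSpace Ω] (X : ℝ≥0 → Ω → MarkedPartition)
    (Q : Measure Ω) (M : ℕ → Ω → ℝ≥0∞) (V : Set ℝ≥0∞) : Prop where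
  countable : V.Countable
  mem : ∀ i ω, M i ω ∈ V
  measurable : ∀ i, Measurable (M i)
  measurableSet : ∀ i, ∀ a ∈ V, MeasurableSet[linePast X {i} fun _ => a] {ω | M i ω = a}
  eq_of_rel : ∀ᵐ ω ∂Q, ∀ i j, (atTime (fun t => X t ω) (M i ω)).rel.r i j → M i ω = M j ω

namespace IsESSF

variable {Ω : Type*} [MeasurableSpace Ω] {α : ℝ} {X : ℝ≥0 → Ω → MarkedPartition}
  {P : Kernel MarkedPartition Ω} [IsMarkovKernel P]

open Classical in
/-- Blocks are frozen at `(·, 0)` or start afresh at distinct finite times. -/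
lemma prob_blockPath_alongLine (hX : IsESSF α X P) {x : ℝ≥0 → MarkedPartition} {m : ℕ → ℝ≥0∞}
    (hm : ∀ i j, (atTime x (m i)).rel.r i j → m i = m j) {J : Finset ℕ} {l : ℕ → ℝ≥0∞}
    (hml : ∀ i ∈ J, m i = l i) {D : ℕ → Set (ℝ≥0 → Set ℕ × ℝ≥0)} (hD : ∀ i, MeasurableSet (D i))
    (T : Finset ℝ≥0) (hT : ∀ i ∈ J, l i ≠ ∞ → (l i).toNNReal ∈ T) :
    P (alongLine x m) {ω | ∀ i ∈ J, blockPath i (fun t => X t ω) ∈ D i} =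
      (if ∀ i ∈ J, l i = ∞ → (fun _ => blockMark i (atInfinity x)) ∈ D i then 1 else 0) *
      ∏ t ∈ T, P (x t) {ω | ∀ i ∈ J.filter (l · = (t : ℝ≥0∞)),
        blockPath i (fun t => X t ω) ∈ D i} := by
  -- Integers related along `m` share a line value, so grouping by the values of `l`, including `∞`,
  -- splits the probability into independent factors.
  have h := hX.prob_blockPath_prod (x := alongLine x m) (J := J) (l := l)
    (fun i hi j hj hij => by rw [← hml i hi, ← hml j hj]; exact hij.1) hD
    (insert ∞ (T.image ((↑) : ℝ≥0 → ℝ≥0∞)))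
  rw [Finset.filter_true_of_mem] at h
  swap
  · intro i hi
    by_cases hi' : l i = ∞
    · simp [hi']
    · exact Finset.mem_insert_of_mem (Finset.mem_image.2 ⟨_, hT i hi hi', ENNReal.coe_toNNReal hi'⟩)
  rw [h, Finset.prod_insert (by simp), Finset.prod_image (by simp)]
  congr 1
  · have hae : ∀ᵐ ω ∂P (alongLine x m), ∀ i, i ∈ J → l i = ∞ →
        blockPath i (fun t => X t ω) = fun _ => blockMark i (atInfinity x) := by
      rw [ae_all_iff]
      intro i
      by_cases hi : i ∈ J ∧ l i = ∞
      · have hmi : m i = ∞ := (hml i hi.1).trans hi.2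
        have hb : blockMark i (alongLine x m) = blockMark i (atInfinity x) := by
          rw [blockMark_alongLine hm, hmi, atTime_top]
        have h0 : (alongLine x m).mark i = 0 := congrArg Prod.snd hb
        filter_upwards [hX.ae_blockMark_eq_of_mark_eq_zero h0] with ω hω _ _
        funext t
        rw [blockPath, hω t, hb]
      · exact Eventually.of_forall fun ω h1 h2 => absurd ⟨h1, h2⟩ hi
    split_ifs with hF
    · refine (measure_congr (eventuallyEq_univ.2 ?_)).trans measure_univ
      filter_upwards [hae] with ω hω i hi
      rw [Finset.mem_filter] at hi
      rw [hω i hi.1 hi.2]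
      exact hF i hi.1 hi.2
    · push Not at hF
      obtain ⟨i, hi, hi', hiD⟩ := hF
      rw [measure_eq_zero_iff_ae_notMem]
      filter_upwards [hae] with ω hω h
      have := h i (Finset.mem_filter.2 ⟨hi, hi'⟩)
      rw [hω i hi hi'] at this
      exact hiD this
  -- At a finite value `t`, the blocks read along the line are blocks of `x t` with the same marks,
  -- so either partition may serve as the initial state.
  · refine Finset.prod_congr rfl fun t _ => hX.prob_blockPath_congr hD fun i hi => ?_
    rw [Finset.mem_filter] at hi
    rw [blockMark_alongLine hm, hml i hi.1, hi.2, atTime_coe]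

/-- The Markov property along a discrete stopping line, for cylinders. -/
lemma prob_discreteLine_cylinder (hX : IsESSF α X P) (μ : Measure MarkedPartition)
    [IsProbabilityMeasure μ] {M : ℕ → Ω → ℝ≥0∞} {V : Set ℝ≥0∞}
    (hM : IsDiscreteLine X (μ.bind P) M V) {J : Finset ℕ} {K : Finset (Coord × ℝ≥0)}
    (hK : ∀ k ∈ K, k.1.support ⊆ J) {E : Set (K → ℝ)} (hE : MeasurableSet E)
    {D : ℕ → Set (ℝ≥0 → Set ℕ × ℝ≥0)} (hD : ∀ i, MeasurableSet (D i)) :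
    μ.bind P ({ω | (fun k : K => coord k.1.1 (stoppedValueAt X (fun i ω => min (M i ω) k.1.2) ω)) ∈ E}
      ∩ {ω | ∀ i ∈ J, blockPath i (fun t : ℝ≥0 => stoppedValueAt X (fun i ω => M i ω + t) ω) ∈ D i}) =
    ∫⁻ ω in {ω | (fun k : K =>
        coord k.1.1 (stoppedValueAt X (fun i ω => min (M i ω) k.1.2) ω)) ∈ E},
      P (stoppedValueAt X M ω) {ω' | ∀ i ∈ J, blockPath i (fun t => X t ω') ∈ D i} ∂(μ.bind P) := by
  set Q := μ.bind P with hQ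
  set B := {ω | (fun k : K => coord k.1.1 (stoppedValueAt X (fun i ω => min (M i ω) k.1.2) ω)) ∈ E}
    with hBdef
  set F := {ω | ∀ i ∈ J, blockPath i
    (fun t : ℝ≥0 => stoppedValueAt X (fun i ω => M i ω + t) ω) ∈ D i} with hFdef
  have hBm : MeasurableSet B := by
    refine measurable_pi_lambda _ (fun k => ?_) hE
    exact (measurable_coord _).comp (measurable_stoppedValueAt hX.measurable hX.cadlag
      fun i => (hM.measurable i).min measurable_const)
  have hFm : MeasurableSet F := by
    have h : Measurable fun ω (t : ℝ≥0) => stoppedValueAt X (fun i ω => M i ω + t) ω :=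
      measurable_pi_lambda _ fun t => measurable_stoppedValueAt hX.measurable hX.cadlag
        fun i => (hM.measurable i).add_const _
    exact h (measurableSet_forall_blockPath J hD)
  have := hM.countable.to_subtype
  -- Only the values of the line on the finite set `J` matter, and there are countably many of them;
  -- both sides are summed over these values.
  let κ : Ω → J → V := fun ω i => ⟨M i ω, hM.mem i ω⟩
  have hκ : ∀ l : J → V, MeasurableSet (κ ⁻¹' {l}) := by
    intro l
    have : κ ⁻¹' {l} = ⋂ i : J, {ω | M i ω = l i} := by
      ext ω
      simp [κ, funext_iff, Subtype.ext_iff]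
    rw [this]
    exact .iInter fun i => hM.measurable i (measurableSet_singleton _)
  have hB : B = ⋃ l : J → V, B ∩ κ ⁻¹' {l} := by
    ext ω
    simp only [mem_iUnion, mem_inter_iff]
    exact ⟨fun h => ⟨κ ω, h, rfl⟩, fun ⟨_, h, _⟩ => h⟩
  have hdisj : Pairwise (Function.onFun Disjoint fun l : J → V => B ∩ κ ⁻¹' {l}) := by
    intro l l' hl
    refine Disjoint.mono inter_subset_right inter_subset_right ?_
    exact Disjoint.preimage κ (by simpa using hl)
  rw [← Measure.restrict_apply' hFm, hB, measure_iUnion hdisj fun l => hBm.inter (hκ l),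
    lintegral_iUnion (fun l => hBm.inter (hκ l)) hdisj]
  refine tsum_congr fun l₀ => ?_
  rw [Measure.restrict_apply' hFm]
  -- The value `0` outside `J` plays no role.
  let l : ℕ → ℝ≥0∞ := fun i => if h : i ∈ J then l₀ ⟨i, h⟩ else 0
  have hκl : ∀ ω, ω ∈ κ ⁻¹' {l₀} ↔ ∀ i ∈ J, M i ω = l i := by
    intro ω
    simp only [κ, mem_preimage, mem_singleton_iff, funext_iff, Subtype.ext_iff, Subtype.forall]
    refine forall₂_congr fun i hi => ?_
    simp only [l, hi, dif_pos]
  have hlV : ∀ i ∈ J, l i ∈ V := fun i hi => by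
    simp only [l, hi, dif_pos]
    exact (l₀ ⟨i, hi⟩).2
  set A := B ∩ κ ⁻¹' {l₀} with hAdef
  -- On `M = l` the stopped coordinates are those along `l`, and each event `M i = l i` is decided
  -- by the block of `i` up to time `l i`.
  have hA : MeasurableSet[linePast X J l] A := by
    have hAeq : A = {ω | (fun k : K => coord k.1.1
        (alongLine (fun t => X t ω) fun i => min (l i) k.1.2)) ∈ E} ∩ ⋂ i ∈ J, {ω | M i ω = l i} := by
      ext ω
      rw [hAdef, mem_inter_iff, mem_inter_iff, hκl, mem_iInter₂]
      refine and_congr_left fun h => ?_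
      have : (fun k : K => coord k.1.1 (stoppedValueAt X (fun i ω => min (M i ω) k.1.2) ω)) =
          fun k : K => coord k.1.1 (alongLine (fun t => X t ω) fun i => min (l i) k.1.2) := by
        funext k
        exact coord_alongLine_congr (fun i hi => congrArg (min · _) (h i hi)) (hK k.1 k.2)
      rw [hBdef, mem_ofPred_eq, this]
      rfl
    rw [hAeq]
    refine MeasurableSet.inter ?_ (J.measurableSet_biInter fun i hi =>
      linePast_singleton_le hi _ (hM.measurableSet i _ (hlV i hi)))
    exact measurable_coords_linePast hK hE
  set T : Finset ℝ≥0 := (J.filter (l · ≠ ∞)).image fun i => (l i).toNNReal with hTdef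
  have hT : ∀ i ∈ J, l i ≠ ∞ → (l i).toNNReal ∈ T := fun i hi h =>
    Finset.mem_image.2 ⟨i, Finset.mem_filter.2 ⟨hi, h⟩, rfl⟩
  set N : Set Ω := {ω | ∀ i ∈ J, l i = ∞ →
    (fun _ : ℝ≥0 => blockMark i (atInfinity fun t => X t ω)) ∈ D i} with hNdef
  have hN : MeasurableSet[linePast X J l] N :=
    measurableSet_frozen hX.cadlag hD
  have hle : linePast X J l ≤ (inferInstance : MeasurableSpace Ω) :=
    iSup₂_le fun p _ => ((measurable_blockMark p.1).comp (hX.measurable p.2)).comap_le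
  -- On `A`, almost surely: the line property yields separation, restarted paths are shifts of `X`
  -- or frozen, and the conditional probability factorises over the finite times once the frozen
  -- blocks meet their constraints.
  have hgood : ∀ᵐ ω ∂Q, ω ∈ A → SeparatedAlong (fun t => X t ω) J l ∧
      (ω ∈ F ↔ ω ∈ N ∧ ∀ t ∈ T, ∀ i ∈ J.filter (l · = (t : ℝ≥0∞)),
        blockPath i (fun s => X (t + s) ω) ∈ D i) ∧
      P (stoppedValueAt X M ω) {ω' | ∀ i ∈ J, blockPath i (fun t => X t ω') ∈ D i} =
        N.indicator (fun ω => ∏ t ∈ T, P (X t ω) {ω' | ∀ i ∈ J.filter (l · = (t : ℝ≥0∞)),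
          blockPath i (fun s => X s ω') ∈ D i}) ω := by
    filter_upwards [hX.ae_refines μ, hM.eq_of_rel] with ω h1 h2 hω
    have hMl := (hκl ω).1 hω.2
    refine ⟨fun i hi j hj hij hr => ?_, ?_, ?_⟩
    · rw [← hMl i hi, ← hMl j hj] at hij
      refine hij.ne (h2 i j ?_)
      rw [atTime, if_neg (hij.trans_le le_top).ne, hMl i hi]
      exact hr
    · have hbp : ∀ i ∈ J, blockPath i
          (fun t : ℝ≥0 => stoppedValueAt X (fun i ω => M i ω + t) ω) =
            fun t : ℝ≥0 => blockMark i (atTime (fun t => X t ω) (l i + t)) := by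
        intro i hi
        funext t
        rw [← hMl i hi]
        exact blockMark_alongLine_add h1 h2 i t
      constructor
      · intro h
        refine ⟨fun i hi hli => ?_, fun t ht i hi => ?_⟩
        · have := h i hi
          rw [hbp i hi] at this
          simpa only [hli, top_add, atTime_top] using this
        · rw [Finset.mem_filter] at hi
          have := h i hi.1
          rw [hbp i hi.1] at this
          simp only [hi.2, ← ENNReal.coe_add, atTime_coe] at this
          exact this
      · rintro ⟨h3, h4⟩ i hi
        rw [hbp i hi]
        rcases eq_or_ne (l i) ∞ with hli | hli
        · simpa only [hli, top_add, atTime_top] using h3 i hi hli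
        · have := h4 _ (hT i hi hli) i (Finset.mem_filter.2 ⟨hi, (ENNReal.coe_toNNReal hli).symm⟩)
          lift l i to ℝ≥0 using hli with a ha
          rw [ENNReal.toNNReal_coe] at this
          simp only [← ENNReal.coe_add, atTime_coe]
          exact this
    · refine (hX.prob_blockPath_alongLine h2 hMl hD T hT).trans ?_
      by_cases hωN : ∀ i ∈ J, l i = ∞ →
        (fun _ : ℝ≥0 => blockMark i (atInfinity fun t => X t ω)) ∈ D i
      · rw [if_pos hωN, indicator_of_mem (show ω ∈ N from hωN), one_mul]
      · rw [if_neg hωN, indicator_of_notMem (show ω ∉ N from hωN), zero_mul]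
  have hprob := hX.prob_line μ hD T (hA.inter hN)
  calc Q (A ∩ F) = Q ((A ∩ N) ∩ {ω | SeparatedAlong (fun t => X t ω) J l ∧
        ∀ t ∈ T, ∀ i ∈ J.filter (l · = (t : ℝ≥0∞)),
          blockPath i (fun s => X (t + s) ω) ∈ D i}) := by
        refine measure_congr ?_
        filter_upwards [hgood] with ω hω
        refine propext ⟨fun h => ?_, fun h => ?_⟩
        · obtain ⟨g1, g2, -⟩ := hω h.1
          exact ⟨⟨h.1, (g2.1 h.2).1⟩, g1, (g2.1 h.2).2⟩
        · obtain ⟨g1, g2, -⟩ := hω h.1.1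
          exact ⟨h.1.1, g2.2 ⟨h.1.2, h.2.2⟩⟩
    _ = _ := hprob
    _ = _ := by
        refine setLIntegral_congr (t := N ∩ A) ?_
        filter_upwards [hgood] with ω hω
        refine propext ⟨fun h => ⟨h.1.2, h.1.1⟩, fun h => ⟨⟨h.2, h.1⟩, (hω h.2).1⟩⟩
    _ = _ := (setLIntegral_indicator (hle _ hN) _).symm
    _ = _ := by
        refine setLIntegral_congr_fun_ae (hle _ hA) ?_
        filter_upwards [hgood] with ω hω h
        exact (hω h).2.2.symm

end IsESSF

/-! ### The joint law of a stopped and a restarted process -/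

/-- Real coordinates of a path. -/
noncomputable def pathCoord (x : ℝ≥0 → MarkedPartition) : Coord × ℝ≥0 → ℝ :=
  fun k => coord k.1 (x k.2)

lemma measurable_pathCoord : Measurable pathCoord :=
  measurable_pi_lambda _ fun k => (measurable_coord k.1).comp (measurable_pi_apply k.2)

lemma measurableSpace_path_eq_comap :
    (MeasurableSpace.pi : MeasurableSpace (ℝ≥0 → MarkedPartition)) =
      MeasurableSpace.comap pathCoord inferInstance := by
  refine le_antisymm (iSup_le fun t => ?_) measurable_pathCoord.comap_le
  refine measurable_iff_comap_le.1 (measurable_of_coord fun c => ?_)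
  exact (measurable_pi_apply (c, t)).comp (comap_measurable pathCoord)

/-- The path stopped along a line. -/
noncomputable def stoppedPath {Ω : Type*} (X : ℝ≥0 → Ω → MarkedPartition) (M : ℕ → Ω → ℝ≥0∞)
    (ω : Ω) (t : ℝ≥0) : MarkedPartition :=
  alongLine (fun t => X t ω) fun i => min (M i ω) t

/-- The path restarted along a line. -/
noncomputable def restartedPath {Ω : Type*} (X : ℝ≥0 → Ω → MarkedPartition) (M : ℕ → Ω → ℝ≥0∞)
    (ω : Ω) (t : ℝ≥0) : MarkedPartition :=
  alongLine (fun t => X t ω) fun i => M i ω + t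

/-- The process that starts from the value along a line and fragments according to independent
copies. -/
noncomputable def branchedPath {Ω : Type*} (α : ℝ) (X : ℝ≥0 → Ω → MarkedPartition)
    (M : ℕ → Ω → ℝ≥0∞) (p : Ω × (ℕ → Ω)) : ℝ≥0 → MarkedPartition :=
  ssfrag α (alongLine (fun t => X t p.1) fun i => M i p.1) fun k t => X t (p.2 k)

section

variable {Ω : Type*} [MeasurableSpace Ω] {X : ℝ≥0 → Ω → MarkedPartition}

lemma measurable_stoppedPath (hm : ∀ t, Measurable (X t)) (hc : ∀ ω, IsCadlag fun t => X t ω)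
    {M : ℕ → Ω → ℝ≥0∞} (hM : ∀ i, Measurable (M i)) : Measurable (stoppedPath X M) :=
  measurable_pi_lambda _ fun _ =>
    measurable_stoppedValueAt hm hc fun i => (hM i).min measurable_const

lemma measurable_restartedPath (hm : ∀ t, Measurable (X t)) (hc : ∀ ω, IsCadlag fun t => X t ω)
    {M : ℕ → Ω → ℝ≥0∞} (hM : ∀ i, Measurable (M i)) : Measurable (restartedPath X M) :=
  measurable_pi_lambda _ fun _ =>
    measurable_stoppedValueAt hm hc fun i => (hM i).add_const _

lemma measurable_branchedPath (hm : ∀ t, Measurable (X t)) (hc : ∀ ω, IsCadlag fun t => X t ω)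
    (α : ℝ) {M : ℕ → Ω → ℝ≥0∞} (hM : ∀ i, Measurable (M i)) : Measurable (branchedPath α X M) :=
  measurable_ssfrag hm hc α ((measurable_stoppedValueAt hm hc hM).comp measurable_fst) measurable_snd

/-- Real coordinates of the stopped and the restarted paths. -/
noncomputable def lineCoord (X : ℝ≥0 → Ω → MarkedPartition) (M : ℕ → Ω → ℝ≥0∞) (ω : Ω) :
    (Coord × ℝ≥0) ⊕ (Coord × ℝ≥0) → ℝ :=
  Sum.elim (pathCoord (stoppedPath X M ω)) (pathCoord (restartedPath X M ω))

/-- Real coordinates of the stopped path and of the process that fragments according to independent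
copies. -/
noncomputable def branchedCoord (α : ℝ) (X : ℝ≥0 → Ω → MarkedPartition) (M : ℕ → Ω → ℝ≥0∞)
    (p : Ω × (ℕ → Ω)) : (Coord × ℝ≥0) ⊕ (Coord × ℝ≥0) → ℝ :=
  Sum.elim (pathCoord (stoppedPath X M p.1)) (pathCoord (branchedPath α X M p))

lemma measurable_sum_elim {β ι κ : Type*} [MeasurableSpace β] {f : β → ι → ℝ} {g : β → κ → ℝ}
    (hf : Measurable f) (hg : Measurable g) : Measurable fun b => Sum.elim (f b) (g b) := by
  refine measurable_pi_lambda _ fun k => ?_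
  rcases k with k | k
  · exact (measurable_pi_apply k).comp hf
  · exact (measurable_pi_apply k).comp hg

lemma measurable_lineCoord (hm : ∀ t, Measurable (X t)) (hc : ∀ ω, IsCadlag fun t => X t ω)
    {M : ℕ → Ω → ℝ≥0∞} (hM : ∀ i, Measurable (M i)) : Measurable (lineCoord X M) :=
  measurable_sum_elim (measurable_pathCoord.comp (measurable_stoppedPath hm hc hM))
    (measurable_pathCoord.comp (measurable_restartedPath hm hc hM))

lemma measurable_branchedCoord (hm : ∀ t, Measurable (X t)) (hc : ∀ ω, IsCadlag fun t => X t ω)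
    (α : ℝ) {M : ℕ → Ω → ℝ≥0∞} (hM : ∀ i, Measurable (M i)) :
    Measurable (branchedCoord α X M) :=
  measurable_sum_elim
    ((measurable_pathCoord.comp (measurable_stoppedPath hm hc hM)).comp measurable_fst)
    (measurable_pathCoord.comp (measurable_branchedPath hm hc α hM))

end

namespace IsESSF

variable {Ω : Type*} [MeasurableSpace Ω] {α : ℝ} {X : ℝ≥0 → Ω → MarkedPartition}
  {P : Kernel MarkedPartition Ω} [IsMarkovKernel P]

/-- The Markov property along a discrete stopping line. -/
lemma prob_discreteLine (hX : IsESSF α X P) (μ : Measure MarkedPartition)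
    [IsProbabilityMeasure μ] {M : ℕ → Ω → ℝ≥0∞} {V : Set ℝ≥0∞}
    (hM : IsDiscreteLine X (μ.bind P) M V) {K : Finset (Coord × ℝ≥0)}
    {E : Set (K → ℝ)} (hE : MeasurableSet E)
    {C : Set (ℝ≥0 → MarkedPartition)} (hC : MeasurableSet C) :
    μ.bind P ({ω | (fun k : K => pathCoord (stoppedPath X M ω) k) ∈ E} ∩
        {ω | restartedPath X M ω ∈ C}) =
      ∫⁻ ω in {ω | (fun k : K => pathCoord (stoppedPath X M ω) k) ∈ E},
        P (stoppedValueAt X M ω) {ω' | (fun t => X t ω') ∈ C} ∂(μ.bind P) := by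
  classical
  set Q := μ.bind P with hQ
  set B := {ω | (fun k : K => pathCoord (stoppedPath X M ω) k) ∈ E} with hBdef
  have hR := measurable_restartedPath hX.measurable hX.cadlag hM.measurable
  have hS := measurable_stoppedValueAt hX.measurable hX.cadlag hM.measurable
  let ν := (Q.restrict B).map (restartedPath X M)
  let ν' := ((Q.restrict B).bind (P.comap _ hS)).map fun ω t => X t ω
  have hν : ∀ C, MeasurableSet C → ν C = Q (B ∩ {ω | restartedPath X M ω ∈ C}) := by
    intro C hC
    rw [Measure.map_apply hR hC, Measure.restrict_apply (hR hC), inter_comm]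
    rfl
  have hν' : ∀ C, MeasurableSet C → ν' C = ∫⁻ ω in B,
      P (stoppedValueAt X M ω) {ω' | (fun t => X t ω') ∈ C} ∂Q := by
    intro C hC
    rw [Measure.map_apply hX.measurable_path hC,
      Measure.bind_apply (hX.measurable_path hC) (Kernel.measurable _).aemeasurable]
    rfl
  have hcyl : ∀ C ∈ blockCylinders, ν C = ν' C := by
    rintro _ ⟨J₀, D, hD, rfl⟩
    have hDm := measurableSet_forall_blockPath J₀ hD
    rw [hν _ hDm, hν' _ hDm]
    -- The set of integers is enlarged to contain the supports of the past coordinates; the added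
    -- integers carry no constraint on the future.
    have h := hX.prob_discreteLine_cylinder μ hM (J := J₀ ∪ K.biUnion fun k => k.1.support) (K := K)
      (fun k hk => (Finset.subset_biUnion_of_mem (fun k : Coord × ℝ≥0 => k.1.support) hk).trans
        Finset.subset_union_right) hE
      (D := fun i => if i ∈ J₀ then D i else univ) (fun i => by split_ifs <;> simp [hD])
    have hset : ∀ x : ℝ≥0 → MarkedPartition, (∀ i ∈ J₀ ∪ K.biUnion fun k => k.1.support,
        blockPath i x ∈ if i ∈ J₀ then D i else univ) ↔ ∀ i ∈ J₀, blockPath i x ∈ D i := by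
      intro x
      constructor
      · intro h i hi
        simpa [hi] using h i (Finset.mem_union_left _ hi)
      · intro h i _
        by_cases hi : i ∈ J₀ <;> simp [hi, h]
    simp only [hset] at h
    exact h
  have hfin : IsFiniteMeasure ν := inferInstance
  have : ν = ν' := ext_of_generate_finite _ generateFrom_blockCylinders isPiSystem_blockCylinders
    hcyl (hcyl univ ⟨∅, fun _ => univ, by simp, by simp⟩)
  rw [← hν C hC, ← hν' C hC, this]

/-- The Markov property along a discrete stopping line, in terms of joint laws. -/
lemma map_lineCoord_of_discrete (hX : IsESSF α X P) (μ : Measure MarkedPartition)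
    [IsProbabilityMeasure μ] {M : ℕ → Ω → ℝ≥0∞} {V : Set ℝ≥0∞}
    (hM : IsDiscreteLine X (μ.bind P) M V) :
    (μ.bind P).map (lineCoord X M) =
      ((μ.bind P).prod (Measure.infinitePi fun _ : ℕ => P one)).map (branchedCoord α X M) := by
  set Q := μ.bind P with hQ
  have hl := measurable_lineCoord hX.measurable hX.cadlag hM.measurable
  have hb := measurable_branchedCoord hX.measurable hX.cadlag α hM.measurable
  refine ext_of_generate_finite (squareCylinders fun _ => {s : Set ℝ | MeasurableSet s})
    generateFrom_squareCylinders.symm (isPiSystem_squareCylinders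
      (fun _ => MeasurableSpace.isPiSystem_measurableSet) (by simp)) ?_ ?_
  · rintro _ ⟨s, t, ht, rfl⟩
    have ht' : ∀ i, MeasurableSet (t i) := fun i => ht i trivial
    have hpi : MeasurableSet ((s : Set ((Coord × ℝ≥0) ⊕ (Coord × ℝ≥0))).pi t) :=
      MeasurableSet.pi s.countable_toSet fun i _ => ht' i
    rw [Measure.map_apply hl hpi, Measure.map_apply hb hpi]
    let E : Set (s.toLeft → ℝ) := univ.pi fun k => t (.inl k)
    have hE : MeasurableSet E := MeasurableSet.univ_pi fun k => ht' _
    let C : Set (ℝ≥0 → MarkedPartition) := {x | ∀ k ∈ s.toRight, pathCoord x k ∈ t (.inr k)}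
    have hC : MeasurableSet C := by
      refine measurableSet_setOfPred.2 (measurable_forall_mem_finset _ fun k _ =>
        measurableSet_setOfPred.1 ?_)
      exact ((measurable_pi_apply k).comp measurable_pathCoord) (ht' (.inr k))
    have hmem : ∀ z : Coord × ℝ≥0 → ℝ, ∀ x, Sum.elim z (pathCoord x) ∈
        (s : Set ((Coord × ℝ≥0) ⊕ (Coord × ℝ≥0))).pi t ↔
          (fun k : s.toLeft => z k) ∈ E ∧ x ∈ C := by
      intro z x
      simp only [Set.mem_pi, Finset.mem_coe, Sum.forall, Sum.elim_inl, Sum.elim_inr, E, C,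
        mem_ofPred_eq, mem_univ, true_imp_iff, Subtype.forall, Finset.mem_toLeft,
        Finset.mem_toRight]
    have h := hX.prob_discreteLine μ hM hE hC
    have e1 : lineCoord X M ⁻¹' (s : Set ((Coord × ℝ≥0) ⊕ (Coord × ℝ≥0))).pi t =
        {ω | (fun k : s.toLeft => pathCoord (stoppedPath X M ω) k) ∈ E} ∩
          {ω | restartedPath X M ω ∈ C} := by
      ext ω
      exact hmem _ _
    have hB : MeasurableSet {ω | (fun k : s.toLeft => pathCoord (stoppedPath X M ω) k) ∈ E} := by
      refine measurable_pi_lambda _ (fun k => ?_) hE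
      exact (measurable_pi_apply (k : Coord × ℝ≥0)).comp (measurable_pathCoord.comp
        (measurable_stoppedPath hX.measurable hX.cadlag hM.measurable))
    -- By Fubini the product measure integrates, over the past, the probability that the copies
    -- attached to the stopped value lie in `C`; branching identifies it with the law started from
    -- that value.
    rw [e1, h, Measure.prod_apply (hb hpi), ← lintegral_indicator hB]
    refine lintegral_congr fun ω => ?_
    by_cases hω : ω ∈ {ω | (fun k : s.toLeft => pathCoord (stoppedPath X M ω) k) ∈ E}
    · rw [indicator_of_mem hω, hX.prob_eq_infinitePi _ hC]
      congr 1
      ext y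
      exact ((hmem _ _).trans (and_iff_right hω)).symm
    · rw [indicator_of_notMem hω]
      symm
      convert measure_empty (μ := Measure.infinitePi fun _ : ℕ => P one)
      ext y
      simp only [mem_empty_iff_false, iff_false]
      exact fun h => hω ((hmem _ _).1 h).1
  · have : IsProbabilityMeasure (Q.map (lineCoord X M)) :=
      Measure.isProbabilityMeasure_map hl.aemeasurable
    have := Measure.isProbabilityMeasure_map
      (μ := Q.prod (Measure.infinitePi fun _ : ℕ => P one)) hb.aemeasurable
    simp

end IsESSF

/-! ### Approximation of stopping lines by discrete ones -/

/-- The lines `l' n` approximate `l` from above. -/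
structure IsUpperApprox (l' : ℕ → ℕ → ℝ≥0∞) (l : ℕ → ℝ≥0∞) : Prop where
  tendsto : ∀ i, Tendsto (fun n => l' n i) atTop (𝓝 (l i))
  le : ∀ n i, l i ≤ l' n i
  ne_top : ∀ n i, l i ≠ ∞ → l' n i ≠ ∞
  eq : ∀ n i j, l i = l j → l' n i = l' n j

namespace IsUpperApprox

variable {l' : ℕ → ℕ → ℝ≥0∞} {l : ℕ → ℝ≥0∞}

lemma min_const (h : IsUpperApprox l' l) (t : ℝ≥0) :
    IsUpperApprox (fun n i => min (l' n i) t) fun i => min (l i) t where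
  tendsto i := (h.tendsto i).min tendsto_const_nhds
  le n i := min_le_min_right _ (h.le n i)
  ne_top n i _ := (min_lt_of_right_lt ENNReal.coe_lt_top).ne
  -- Equal capped times come either from equal times or from two times at least `t`; in the second
  -- case the approximations, being larger, are capped as well.
  eq n i j hij := by
    have key : ∀ i j, min (l i) t = min (l j) t → l i < t → l i = l j := fun i j hij hi => by
      rw [min_eq_left hi.le] at hij
      rw [hij, min_eq_left]
      by_contra h'
      rw [min_eq_right (not_le.1 h').le] at hij
      exact hi.ne hij
    rcases lt_or_ge (l i) t with hi | hi
    · exact congrArg (min · _) (h.eq n i j (key i j hij hi))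
    rcases lt_or_ge (l j) t with hj | hj
    · exact congrArg (min · _) (h.eq n j i (key j i hij.symm hj)).symm
    · change min _ _ = min _ _
      rw [min_eq_right (hi.trans (h.le n i)), min_eq_right (hj.trans (h.le n j))]

lemma add_const (h : IsUpperApprox l' l) (t : ℝ≥0) :
    IsUpperApprox (fun n i => l' n i + t) fun i => l i + t where
  tendsto i := (h.tendsto i).add tendsto_const_nhds
  le n i := by gcongr; exact h.le n i
  ne_top n i hi := ENNReal.add_ne_top.2 ⟨h.ne_top n i fun h' => hi (by simp [h']), by simp⟩
  eq n i j hij := by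
    rw [h.eq n i j ((ENNReal.add_left_inj ENNReal.coe_ne_top).1 hij)]

lemma tendsto_coord_atTime (h : IsUpperApprox l' l) {x : ℝ≥0 → MarkedPartition}
    (hx : IsCadlag x) (c : Coord) (i : ℕ) :
    Tendsto (fun n => coord c (atTime x (l' n i))) atTop (𝓝 (coord c (atTime x (l i)))) := by
  rcases eq_or_ne (l i) ∞ with hi | hi
  · have : ∀ n, l' n i = ∞ := fun n => top_le_iff.1 (hi ▸ h.le n i)
    simp only [this, hi]
    exact tendsto_const_nhds
  · simp only [atTime, hi, h.ne_top _ i hi, if_false]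
    refine (hx.tendsto_coord c _).comp (tendsto_nhdsWithin_iff.2 ⟨?_, ?_⟩)
    · exact (ENNReal.tendsto_toNNReal hi).comp (h.tendsto i)
    · exact Eventually.of_forall fun n => ENNReal.toNNReal_mono (h.ne_top n i hi) (h.le n i)

/-- If `l i = l j`, the approximations agree too and the relation is read at a common time
decreasing to the limit. Otherwise they eventually differ, and the clause on times makes the
relation false on both sides. -/
lemma tendsto_coord_alongLine (h : IsUpperApprox l' l) {x : ℝ≥0 → MarkedPartition}
    (hx : IsCadlag x) (c : Coord) :
    Tendsto (fun n => coord c (alongLine x (l' n))) atTop (𝓝 (coord c (alongLine x l))) := by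
  rcases c with ⟨i, j⟩ | i | i
  · by_cases hij : l i = l j
    · have key : ∀ l : ℕ → ℝ≥0∞, l i = l j →
          coord (.inl (i, j)) (alongLine x l) = coord (.inl (i, j)) (atTime x (l i)) := by
        intro l hl
        have : (alongLine x l).rel.r i j ↔ (atTime x (l i)).rel.r i j := and_iff_right hl
        classical
        exact if_congr this rfl rfl
      rw [key l hij]
      exact (h.tendsto_coord_atTime hx _ i).congr fun n => (key _ (h.eq n i j hij)).symm
    · have key : ∀ l : ℕ → ℝ≥0∞, l i ≠ l j → coord (.inl (i, j)) (alongLine x l) = 0 :=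
        fun l hl => if_neg fun h => hl h.1
      rw [key l hij]
      have hne : ∀ᶠ n in atTop, l' n i ≠ l' n j :=
        ((h.tendsto i).prodMk_nhds (h.tendsto j)).eventually
          (isClosed_diagonal.isOpen_compl.mem_nhds (x := (l i, l j)) hij)
      exact tendsto_const_nhds.congr' (hne.mono fun n hn => (key _ hn).symm)
  · exact h.tendsto_coord_atTime hx (.inr (.inl i)) i
  · exact h.tendsto_coord_atTime hx (.inr (.inr i)) i

end IsUpperApprox

/-- The smallest multiple of `1 / (n + 1)` above `a`. -/
noncomputable def lineCeil (n : ℕ) (a : ℝ≥0∞) : ℝ≥0∞ :=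
  if a = ∞ then ∞ else (gridCeil n a.toNNReal : ℝ≥0)

lemma lineCeil_top (n : ℕ) : lineCeil n ∞ = ∞ := if_pos rfl

lemma lineCeil_coe (n : ℕ) (a : ℝ≥0) : lineCeil n a = gridCeil n a := by simp [lineCeil]

lemma isUpperApprox_lineCeil (l : ℕ → ℝ≥0∞) : IsUpperApprox (fun n i => lineCeil n (l i)) l where
  tendsto i := by
    induction l i with
    | top => simp only [lineCeil_top]; exact tendsto_const_nhds
    | coe a =>
      simp only [lineCeil_coe]
      exact ENNReal.tendsto_coe.2 (tendsto_nhdsWithin_iff.1 (tendsto_gridCeil a)).1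
  le n i := by
    induction l i with
    | top => simp [lineCeil_top]
    | coe a => rw [lineCeil_coe]; exact ENNReal.coe_le_coe.2 (le_gridCeil n a)
  ne_top n i hi := by simp [lineCeil, hi]
  eq n i j h := congrArg _ h

/-- The rounded value is decided by comparing `s` with grid points up to that value, as the stopping
property requires. -/
lemma gridCeil_eq_iff {n k : ℕ} {s : ℝ≥0} : gridCeil n s = k / (n + 1) ↔
    s ≤ k / (n + 1) ∧ ∀ m < k, ¬ s ≤ (m : ℝ≥0) / (n + 1) := by
  have h : ∀ m : ℕ, s ≤ (m : ℝ≥0) / (n + 1) ↔ ⌈((n : ℝ≥0) + 1) * s⌉₊ ≤ m := by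
    intro m
    rw [Nat.ceil_le, le_div_iff₀ (by positivity), mul_comm]
  simp only [h, gridCeil, not_le]
  rw [div_left_inj' (by positivity), Nat.cast_inj]
  exact ⟨fun h => ⟨h.le, fun m hm => h.symm ▸ hm⟩,
    fun h => le_antisymm h.1 (le_of_not_gt fun h' => (h.2 _ h').false)⟩

lemma measurable_lineCeil (n : ℕ) : Measurable (lineCeil n) := by
  refine Measurable.ite (measurableSet_singleton _) measurable_const ?_
  refine measurable_coe_nnreal_ennreal.comp (Measurable.div_const ?_ _)
  exact measurable_from_top.comp
    ((measurable_gridCeil_index n).comp ENNReal.measurable_toNNReal)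

/-! ### Continuity of the fragmentation operator -/

/-- The bound `min 1 (v ^ 3) * (1 + m ^ 3) ≤ 1 + (v * m) ^ 3` controls the product for `m` near `0`
and near `∞` at once, as long as `v` stays away from `0` and `∞`. -/
lemma circleFst_mul_le {v m : ℝ≥0} (hv : v ≠ 0) :
    circleFst (v * m) ≤ v / min 1 ((v : ℝ) ^ 3) * circleFst m := by
  have hv' : (0 : ℝ) < v := by exact_mod_cast pos_iff_ne_zero.2 hv
  have hmin : 0 < min 1 ((v : ℝ) ^ 3) := lt_min one_pos (by positivity)
  have hle : min 1 ((v : ℝ) ^ 3) * (1 + (m : ℝ) ^ 3) ≤ 1 + ((v : ℝ) * m) ^ 3 := by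
    rw [mul_pow, mul_add, mul_one]
    gcongr
    · exact min_le_left _ _
    · exact min_le_right _ _
  unfold circleFst
  rw [div_mul_div_comm, NNReal.coe_mul]
  gcongr

lemma circleSnd_mul_le {v m : ℝ≥0} (hv : v ≠ 0) :
    circleSnd (v * m) ≤ (v : ℝ) ^ 2 / min 1 ((v : ℝ) ^ 3) * circleSnd m := by
  have hv' : (0 : ℝ) < v := by exact_mod_cast pos_iff_ne_zero.2 hv
  have hmin : 0 < min 1 ((v : ℝ) ^ 3) := lt_min one_pos (by positivity)
  have hle : min 1 ((v : ℝ) ^ 3) * (1 + (m : ℝ) ^ 3) ≤ 1 + ((v : ℝ) * m) ^ 3 := by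
    rw [mul_pow, mul_add, mul_one]
    gcongr
    · exact min_le_left _ _
    · exact min_le_right _ _
  unfold circleSnd
  rw [div_mul_div_comm, NNReal.coe_mul, mul_pow (v : ℝ) m 2]
  gcongr

lemma tendsto_of_tendsto_circle {m' : ℕ → ℝ≥0} {m : ℝ≥0} (hm : m ≠ 0)
    (h1 : Tendsto (fun n => circleFst (m' n)) atTop (𝓝 (circleFst m)))
    (h2 : Tendsto (fun n => circleSnd (m' n)) atTop (𝓝 (circleSnd m))) :
    Tendsto m' atTop (𝓝 m) := by
  rw [← NNReal.tendsto_coe, ← circleSnd_div_circleFst]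
  exact (h2.div h1 (circleFst_pos hm).ne').congr fun n => circleSnd_div_circleFst _

/-- Away from `0` the circle has the usual topology. When `m = 0` the marks `m'` may oscillate
between `0` and `∞`, and the multiplicative bounds on the coordinates replace convergence in `[0,
∞)`. -/
lemma tendsto_circle_mul {v' m' : ℕ → ℝ≥0} {v m : ℝ≥0} (hv : Tendsto v' atTop (𝓝 v)) (hv0 : v ≠ 0)
    (h1 : Tendsto (fun n => circleFst (m' n)) atTop (𝓝 (circleFst m)))
    (h2 : Tendsto (fun n => circleSnd (m' n)) atTop (𝓝 (circleSnd m))) :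
    Tendsto (fun n => circleFst (v' n * m' n)) atTop (𝓝 (circleFst (v * m))) ∧
      Tendsto (fun n => circleSnd (v' n * m' n)) atTop (𝓝 (circleSnd (v * m))) := by
  by_cases hm : m = 0
  · subst hm
    rw [circleFst_zero] at h1
    rw [circleSnd_zero] at h2
    rw [mul_zero, circleFst_zero, circleSnd_zero]
    have hv' : Tendsto (fun n => (v' n : ℝ)) atTop (𝓝 v) := NNReal.tendsto_coe.2 hv
    have hne : min 1 ((v : ℝ) ^ 3) ≠ 0 := by
      have : (0 : ℝ) < v := by exact_mod_cast pos_iff_ne_zero.2 hv0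
      exact (lt_min one_pos (by positivity)).ne'
    have hmin : Tendsto (fun n => min 1 ((v' n : ℝ) ^ 3)) atTop (𝓝 (min 1 ((v : ℝ) ^ 3))) :=
      tendsto_const_nhds.min (hv'.pow 3)
    have b1 := (hv'.div hmin hne).mul h1
    have b2 := ((hv'.pow 2).div hmin hne).mul h2
    rw [mul_zero] at b1 b2
    have hev : ∀ᶠ n in atTop, v' n ≠ 0 := hv.eventually_ne hv0
    exact ⟨squeeze_zero' (Eventually.of_forall fun n => circleFst_nonneg _)
        (hev.mono fun n hn => circleFst_mul_le hn) b1,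
      squeeze_zero' (Eventually.of_forall fun n => circleSnd_nonneg _)
        (hev.mono fun n hn => circleSnd_mul_le hn) b2⟩
  · have h := hv.mul (tendsto_of_tendsto_circle hm h1 h2)
    exact ⟨(continuous_circleFst.tendsto _).comp h, (continuous_circleSnd.tendsto _).comp h⟩

lemma continuousAt_markPow (α : ℝ) {v : ℝ≥0} (hv : v ≠ 0) :
    ContinuousAt (fun v => markPow v α) v := by
  have h : (fun v : ℝ≥0 => markPow v α) =ᶠ[𝓝 v] fun v => v ^ α := by
    filter_upwards [isOpen_ne.mem_nhds hv] with w hw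
    exact if_neg hw
  exact (NNReal.continuousAt_rpow_const (Or.inl hv)).congr h.symm

lemma coord_rel_ssfrag (α : ℝ) (x : MarkedPartition) (y : ℕ → ℝ≥0 → MarkedPartition) (t : ℝ≥0)
    (i j : ℕ) : coord (.inl (i, j)) (ssfrag α x y t) = coord (.inl (i, j)) x *
      coord (.inl (i, j)) (y (x.label i) (markPow (x.mark i) α * t)) := by
  classical
  have h : (ssfrag α x y t).rel.r i j ↔ x.rel.r i j ∧
    (y (x.label i) (markPow (x.mark i) α * t)).rel.r i j := Iff.rfl
  by_cases h1 : x.rel.r i j <;>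
    by_cases h2 : (y (x.label i) (markPow (x.mark i) α * t)).rel.r i j <;>
      simp [coord, h, h1, h2]

/-- The fragmentation operator is continuous, provided that blocks of mark `0` are approximated by
blocks of mark `0` and that the fragmenting paths are continuous at the times in question. -/
lemma tendsto_coord_ssfrag (α : ℝ) {x' : ℕ → MarkedPartition} {x : MarkedPartition}
    (hx : ∀ c, Tendsto (fun n => coord c (x' n)) atTop (𝓝 (coord c x)))
    (h0 : ∀ i, x.mark i = 0 → ∀ n, (x' n).mark i = 0) {y : ℕ → ℝ≥0 → MarkedPartition} {t : ℝ≥0}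
    (hy : ∀ i c, ContinuousAt (fun s => coord c (y (x.label i) s)) (markPow (x.mark i) α * t))
    (c : Coord) :
    Tendsto (fun n => coord c (ssfrag α (x' n) y t)) atTop (𝓝 (coord c (ssfrag α x y t))) := by
  -- The label of `i` depends on finitely many relations, each of which is eventually constant.
  have hlabel : ∀ i, ∀ᶠ n in atTop, (x' n).label i = x.label i := by
    intro i
    have h : ∀ᶠ n in atTop, ∀ p ∈ Finset.range (i + 1) ×ˢ Finset.range (i + 1),
        ((x' n).rel.r p.1 p.2 ↔ x.rel.r p.1 p.2) :=
      (Finset.eventually_all _).2 fun p _ => eventually_rel_of_tendsto (hx (.inl p))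
    filter_upwards [h] with n hn
    refine label_congr fun j hj k hk => hn (j, k) ?_
    simp only [Finset.mem_product, Finset.mem_range]
    omega
  have hmark : ∀ i, x.mark i ≠ 0 → Tendsto (fun n => (x' n).mark i) atTop (𝓝 (x.mark i)) :=
    fun i hi => tendsto_of_tendsto_circle hi (hx (.inr (.inl i))) (hx (.inr (.inr i)))
  have hy' : ∀ i c, Tendsto
      (fun n => coord c (y ((x' n).label i) (markPow ((x' n).mark i) α * t))) atTop
      (𝓝 (coord c (y (x.label i) (markPow (x.mark i) α * t)))) := by
    intro i c
    have hs : Tendsto (fun n => markPow ((x' n).mark i) α * t) atTop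
        (𝓝 (markPow (x.mark i) α * t)) := by
      by_cases hi : x.mark i = 0
      · simp only [h0 i hi, hi]
        exact tendsto_const_nhds
      · exact ((continuousAt_markPow α hi).tendsto.comp (hmark i hi)).mul_const t
    refine ((hy i c).tendsto.comp hs).congr' ((hlabel i).mono fun n hn => ?_)
    simp only [Function.comp_apply, hn]
  have hmul : ∀ i, Tendsto (fun n => circleFst ((ssfrag α (x' n) y t).mark i)) atTop
        (𝓝 (circleFst ((ssfrag α x y t).mark i))) ∧
      Tendsto (fun n => circleSnd ((ssfrag α (x' n) y t).mark i)) atTop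
        (𝓝 (circleSnd ((ssfrag α x y t).mark i))) := by
    intro i
    by_cases hi : x.mark i = 0
    · have h1 : (ssfrag α x y t).mark i = 0 := by
        change x.mark i * _ = 0
        rw [hi, zero_mul]
      have h2 : ∀ n, (ssfrag α (x' n) y t).mark i = 0 := fun n => by
        change (x' n).mark i * _ = 0
        rw [h0 i hi, zero_mul]
      simp only [h1, h2]
      exact ⟨tendsto_const_nhds, tendsto_const_nhds⟩
    · exact tendsto_circle_mul (hmark i hi) hi (hy' i (.inr (.inl i))) (hy' i (.inr (.inr i)))
  rcases c with ⟨i, j⟩ | i | i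
  · simp only [coord_rel_ssfrag]
    exact (hx _).mul (hy' i _)
  · exact (hmul i).1
  · exact (hmul i).2

/-! ### Limits of equalities in law. -/

lemma tendsto_integral_map {β S : Type*} [MeasurableSpace β] [TopologicalSpace S]
    [MeasurableSpace S] [BorelSpace S] [TopologicalSpace.PseudoMetrizableSpace S]
    [SecondCountableTopology S] {μ : Measure β} [IsFiniteMeasure μ] {f' : ℕ → β → S} {f : β → S}
    (hf' : ∀ n, Measurable (f' n)) (hf : Measurable f)
    (hfl : ∀ᵐ b ∂μ, Tendsto (fun n => f' n b) atTop (𝓝 (f b))) (φ : BoundedContinuousFunction S ℝ) :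
    Tendsto (fun n => ∫ s, φ s ∂(μ.map (f' n))) atTop (𝓝 (∫ s, φ s ∂(μ.map f))) := by
  rw [integral_map hf.aemeasurable φ.continuous.aestronglyMeasurable]
  simp_rw [fun n => integral_map (μ := μ) (hf' n).aemeasurable φ.continuous.aestronglyMeasurable]
  refine tendsto_integral_of_dominated_convergence (fun _ => ‖φ‖)
    (fun n => (φ.continuous.measurable.comp (hf' n)).aestronglyMeasurable)
    (integrable_const _) (fun n => Eventually.of_forall fun b => φ.norm_coe_le_norm _) ?_
  filter_upwards [hfl] with b hb
  exact (φ.continuous.tendsto _).comp hb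

/-- Equality in law is preserved by almost sure limits. -/
lemma map_eq_map_of_tendsto {β γ S : Type*} [MeasurableSpace β] [MeasurableSpace γ]
    [TopologicalSpace S] [MeasurableSpace S] [BorelSpace S] [HasOuterApproxClosed S]
    [TopologicalSpace.PseudoMetrizableSpace S] [SecondCountableTopology S]
    {μ : Measure β} {ν : Measure γ} [IsFiniteMeasure μ] [IsFiniteMeasure ν]
    {f' : ℕ → β → S} {f : β → S} {g' : ℕ → γ → S} {g : γ → S}
    (hf' : ∀ n, Measurable (f' n)) (hf : Measurable f) (hg' : ∀ n, Measurable (g' n))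
    (hg : Measurable g) (h : ∀ n, μ.map (f' n) = ν.map (g' n))
    (hfl : ∀ᵐ b ∂μ, Tendsto (fun n => f' n b) atTop (𝓝 (f b)))
    (hgl : ∀ᵐ c ∂ν, Tendsto (fun n => g' n c) atTop (𝓝 (g c))) : μ.map f = ν.map g := by
  refine ext_of_forall_integral_eq_of_IsFiniteMeasure fun φ => ?_
  have h1 := tendsto_integral_map hf' hf hfl φ
  have h2 := tendsto_integral_map hg' hg hgl φ
  simp only [h] at h1
  exact tendsto_nhds_unique h1 h2

/-! ### The Markov property along stopping lines -/

lemma measurable_blockFiltration_le_linePast {Ω : Type*} [MeasurableSpace Ω]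
    {X : ℝ≥0 → Ω → MarkedPartition} (hm : ∀ t, Measurable (X t)) (i : ℕ) {t : ℝ≥0} {a : ℝ≥0∞}
    (h : (t : ℝ≥0∞) ≤ a) : blockFiltration X hm i t ≤ linePast X {i} fun _ => a := by
  refine iSup₂_le fun s hs => ?_
  have hb := measurable_blockMark_linePast (X := X) (l := fun _ => a) (Finset.mem_singleton_self i)
    ((ENNReal.coe_le_coe.2 hs).trans h)
  exact sup_le hb.fst.comap_le hb.snd.comap_le

namespace IsESSF

variable {Ω : Type*} [MeasurableSpace Ω] {α : ℝ} {X : ℝ≥0 → Ω → MarkedPartition}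
  {P : Kernel MarkedPartition Ω} [IsMarkovKernel P]

/-- Rounding a stopping line up gives a discrete stopping line. -/
lemma isDiscreteLine_lineCeil (hX : IsESSF α X P) (μ : Measure MarkedPartition)
    [IsProbabilityMeasure μ] {L : ℕ → Ω → ℝ≥0∞}
    (hL : IsStoppingLine X hX.measurable (μ.bind P) L) (n : ℕ) :
    IsDiscreteLine X (μ.bind P) (fun i ω => lineCeil n (L i ω))
      (insert ∞ (range fun k : ℕ => (((k : ℝ≥0) / (n + 1) : ℝ≥0) : ℝ≥0∞))) where
  countable := (countable_range _).insert _
  mem i ω := by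
    induction L i ω with
    | top => rw [lineCeil_top]; exact mem_insert _ _
    | coe a => rw [lineCeil_coe]; exact mem_insert_of_mem _ ⟨_, rfl⟩
  measurable i := (measurable_lineCeil n).comp (hL.measurable i)
  measurableSet i a ha := by
    have hle : ∀ t : ℝ≥0, (t : ℝ≥0∞) ≤ a →
        MeasurableSet[linePast X {i} fun _ => a] {ω | L i ω ≤ t} := fun t ht =>
      measurable_blockFiltration_le_linePast hX.measurable i ht _ (hL.isStoppingTime i t)
    rcases ha with rfl | ⟨k, rfl⟩
    -- Rounding up keeps finite times finite, so the value `∞` is the complement of the events `L i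
    -- ≤ m`.
    · have : {ω | lineCeil n (L i ω) = ∞} = (⋃ m : ℕ, {ω | L i ω ≤ ((m : ℝ≥0) : ℝ≥0∞)})ᶜ := by
        ext ω
        simp only [mem_ofPred_eq, mem_compl_iff, mem_iUnion, not_exists]
        induction L i ω with
        | top => simp [lineCeil_top]
        | coe a =>
          obtain ⟨m, hm⟩ := exists_nat_ge a
          simp only [lineCeil_coe, ENNReal.coe_ne_top, false_iff, not_forall, not_not]
          exact ⟨m, ENNReal.coe_le_coe.2 hm⟩
      rw [this]
      exact (MeasurableSet.iUnion fun (m : ℕ) => hle m le_top).compl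
    · beta_reduce at hle ⊢
      have : {ω | lineCeil n (L i ω) = (((k : ℝ≥0) / (n + 1) : ℝ≥0) : ℝ≥0∞)} =
          {ω | L i ω ≤ (((k : ℝ≥0) / (n + 1) : ℝ≥0) : ℝ≥0∞)} ∩
            ⋂ m ∈ Finset.range k, {ω | L i ω ≤ ((((m : ℕ) : ℝ≥0) / (n + 1) : ℝ≥0) : ℝ≥0∞)}ᶜ := by
        ext ω
        simp only [mem_ofPred_eq, mem_compl_iff, mem_inter_iff, mem_iInter, Finset.mem_range]
        induction L i ω with
        | top =>
          simp only [lineCeil_top, ENNReal.top_ne_coe, top_le_iff, ENNReal.coe_ne_top, false_and]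
        | coe a =>
          simp only [lineCeil_coe, ENNReal.coe_inj, ENNReal.coe_le_coe]
          exact gridCeil_eq_iff
      rw [this]
      refine (hle _ le_rfl).inter
        (Finset.measurableSet_biInter _ fun (m : ℕ) hm => (hle _ ?_).compl)
      refine ENNReal.coe_le_coe.2 ?_
      have : (m : ℝ≥0) ≤ k := Nat.cast_le.2 (Finset.mem_range.1 hm).le
      gcongr
  eq_of_rel := by
    -- Integers still related at the later, rounded time are related at `L i` by refinement, hence
    -- share the same `L` and the same rounding.
    filter_upwards [hX.ae_refines μ, hL.eq_of_rel] with ω h1 h2 i j h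
    rw [h2 i j]
    induction hLi : L i ω with
    | top => rwa [hLi, lineCeil_top] at h
    | coe a =>
      rw [hLi, lineCeil_coe, atTime_coe] at h
      rw [atTime_coe]
      exact h1 _ _ (le_gridCeil n a) i j h

/-- Along a stopping line, marks that vanish have vanished for good. -/
lemma ae_mark_lineCeil_eq_zero (hX : IsESSF α X P) (μ : Measure MarkedPartition)
    {L : ℕ → Ω → ℝ≥0∞} (hL : IsStoppingLine X hX.measurable (μ.bind P) L) :
    ∀ᵐ ω ∂(μ.bind P), ∀ i, (stoppedValueAt X L ω).mark i = 0 →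
      ∀ n, (stoppedValueAt X (fun i ω => lineCeil n (L i ω)) ω).mark i = 0 := by
  rw [ae_all_iff]
  intro i
  filter_upwards [hX.ae_frozen_of_stoppingTime μ (hL.isStoppingTime i)] with ω hω h0 n
  change (atTime (fun t => X t ω) (L i ω)).mark i = 0 at h0
  change (atTime (fun t => X t ω) (lineCeil n (L i ω))).mark i = 0
  induction hLi : L i ω with
  | top => rw [lineCeil_top, atTime_top]; rfl
  | coe a =>
    rw [hLi] at hω h0
    rw [lineCeil_coe, atTime_coe]
    rw [atTime_coe] at h0
    have h := hω ENNReal.coe_ne_top h0 (gridCeil n a - a)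
    rw [ENNReal.toNNReal_coe, add_tsub_cancel_of_le (le_gridCeil n a)] at h
    exact (congrArg Prod.snd h).trans h0

/-- The Markov property along a stopping line, in terms of joint laws. -/
lemma map_lineCoord (hX : IsESSF α X P) (μ : Measure MarkedPartition)
    [IsProbabilityMeasure μ] {L : ℕ → Ω → ℝ≥0∞}
    (hL : IsStoppingLine X hX.measurable (μ.bind P) L) :
    (μ.bind P).map (lineCoord X L) =
      ((μ.bind P).prod (Measure.infinitePi fun _ : ℕ => P one)).map (branchedCoord α X L) := by
  have hD := hX.isDiscreteLine_lineCeil μ hL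
  have hl' := fun n => measurable_lineCoord hX.measurable hX.cadlag (hD n).measurable
  have hl := measurable_lineCoord hX.measurable hX.cadlag hL.measurable
  have hb' := fun n => measurable_branchedCoord hX.measurable hX.cadlag α (hD n).measurable
  have hb := measurable_branchedCoord hX.measurable hX.cadlag α hL.measurable
  have happ : ∀ ω, IsUpperApprox (fun n i => lineCeil n (L i ω)) fun i => L i ω := fun ω =>
    isUpperApprox_lineCeil _
  have hmin : ∀ ω k, Tendsto
      (fun n => pathCoord (stoppedPath X (fun i ω => lineCeil n (L i ω)) ω) k) atTop
      (𝓝 (pathCoord (stoppedPath X L ω) k)) := fun ω k =>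
    ((happ ω).min_const k.2).tendsto_coord_alongLine (hX.cadlag ω) k.1
  have hlim : ∀ ω k, Tendsto (fun n => lineCoord X (fun i ω => lineCeil n (L i ω)) ω k) atTop
      (𝓝 (lineCoord X L ω k)) := by
    rintro ω (k | k)
    · exact hmin ω k
    · exact ((happ ω).add_const k.2).tendsto_coord_alongLine (hX.cadlag ω) k.1
  have hblim : ∀ k, ∀ᵐ p ∂((μ.bind P).prod (Measure.infinitePi fun _ : ℕ => P one)),
      Tendsto (fun n => branchedCoord α X (fun i ω => lineCeil n (L i ω)) p k) atTop
        (𝓝 (branchedCoord α X L p k)) := by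
    rintro (k | k)
    · exact Eventually.of_forall fun p => hmin p.1 k
    · have hmeas : MeasurableSet {p | Tendsto
          (fun n => branchedCoord α X (fun i ω => lineCeil n (L i ω)) p (.inr k)) atTop
          (𝓝 (branchedCoord α X L p (.inr k)))} :=
        measurableSet_tendsto_fun (fun n => (measurable_pi_apply (Sum.inr k)).comp (hb' n))
          ((measurable_pi_apply (Sum.inr k)).comp hb)
      -- With `ω` fixed, the times at which the copies are read are deterministic, so the absence of
      -- fixed discontinuities applies to them.
      refine (Measure.ae_prod_iff_ae_ae hmeas).2 ?_
      filter_upwards [hX.ae_mark_lineCeil_eq_zero μ hL] with ω hω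
      have hy : ∀ᵐ y ∂(Measure.infinitePi fun _ : ℕ => P one), ∀ i c, ContinuousAt
          (fun s => coord c (X s (y ((stoppedValueAt X L ω).label i))))
          (markPow ((stoppedValueAt X L ω).mark i) α * k.2) := by
        simp only [ae_all_iff]
        intro i c
        exact (measurePreserving_eval_infinitePi (fun _ : ℕ => P one) _).quasiMeasurePreserving.ae
          (hX.ae_continuousAt_coord one _ c)
      filter_upwards [hy] with y hy
      exact tendsto_coord_ssfrag α (fun c => (happ ω).tendsto_coord_alongLine (hX.cadlag ω) c)
        hω (y := fun k t => X t (y k)) hy k.1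
  -- The index set is uncountable, while almost sure convergence is known one coordinate at a time;
  -- finite marginals suffice to identify the laws.
  refine IsProjectiveLimit.unique
    (P := fun I => ((μ.bind P).map (lineCoord X L)).map I.restrict) (fun I => rfl) fun I => ?_
  change Measure.map I.restrict _ = Measure.map I.restrict _
  rw [Measure.map_map (Finset.measurable_restrict I) hl,
    Measure.map_map (Finset.measurable_restrict I) hb]
  symm
  refine map_eq_map_of_tendsto
    (f' := fun n => I.restrict ∘ lineCoord X (fun i ω => lineCeil n (L i ω)))
    (g' := fun n => I.restrict ∘ branchedCoord α X (fun i ω => lineCeil n (L i ω)))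
    (fun n => (Finset.measurable_restrict I).comp (hl' n))
    ((Finset.measurable_restrict I).comp hl)
    (fun n => (Finset.measurable_restrict I).comp (hb' n))
    ((Finset.measurable_restrict I).comp hb) (fun n => ?_) ?_ ?_
  · rw [← Measure.map_map (Finset.measurable_restrict I) (hl' n),
      ← Measure.map_map (Finset.measurable_restrict I) (hb' n),
      hX.map_lineCoord_of_discrete μ (hD n)]
  · exact Eventually.of_forall fun ω => tendsto_pi_nhds.2 fun k => hlim ω k
  · have : ∀ᵐ p ∂((μ.bind P).prod (Measure.infinitePi fun _ : ℕ => P one)), ∀ k : I,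
        Tendsto (fun n => branchedCoord α X (fun i ω => lineCeil n (L i ω)) p k) atTop
          (𝓝 (branchedCoord α X L p k)) := ae_all_iff.2 fun k => hblim k
    filter_upwards [this] with p hp
    exact tendsto_pi_nhds.2 fun k => hp k

/-- The Markov property along a stopping line, on events of the past of the line. -/
lemma prob_stoppingLine (hX : IsESSF α X P) (μ : Measure MarkedPartition)
    [IsProbabilityMeasure μ] {L : ℕ → Ω → ℝ≥0∞}
    (hL : IsStoppingLine X hX.measurable (μ.bind P) L) {A : Set Ω}
    (hA : MeasurableSet[lineSigma X L] A) {C : Set (ℝ≥0 → MarkedPartition)}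
    (hC : MeasurableSet C) :
    μ.bind P (A ∩ {ω | restartedPath X L ω ∈ C}) =
      ((μ.bind P).prod (Measure.infinitePi fun _ : ℕ => P one))
        (Prod.fst ⁻¹' A ∩ {p | branchedPath α X L p ∈ C}) := by
  -- An event of the past of the line is an event on the coordinates of the stopped path, so it is
  -- seen by the joint law.
  have hle : lineSigma X L ≤
      MeasurableSpace.comap (fun ω => pathCoord (stoppedPath X L ω)) inferInstance := by
    refine iSup_le fun t => measurable_iff_comap_le.1 (measurable_of_coord fun c => ?_)
    exact (measurable_pi_apply (c, t)).comp
      (comap_measurable fun ω => pathCoord (stoppedPath X L ω))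
  obtain ⟨A, hA', rfl⟩ := hle _ hA
  rw [measurableSpace_path_eq_comap] at hC
  obtain ⟨C, hC', rfl⟩ := hC
  have hl := measurable_lineCoord hX.measurable hX.cadlag hL.measurable
  have hb := measurable_branchedCoord hX.measurable hX.cadlag α hL.measurable
  have hS : MeasurableSet {z : (Coord × ℝ≥0) ⊕ (Coord × ℝ≥0) → ℝ |
      (fun k => z (.inl k)) ∈ A ∧ (fun k => z (.inr k)) ∈ C} := by
    refine MeasurableSet.inter ?_ ?_
    · exact (measurable_pi_lambda _ fun k => measurable_pi_apply (Sum.inl k)) hA'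
    · exact (measurable_pi_lambda _ fun k => measurable_pi_apply (Sum.inr k)) hC'
  have h := DFunLike.congr_fun (hX.map_lineCoord μ hL) {z | (fun k => z (.inl k)) ∈ A ∧
    (fun k => z (.inr k)) ∈ C}
  rw [Measure.map_apply hl hS, Measure.map_apply hb hS] at h
  exact h

end IsESSF

theorem mainTheorem6 {Ω : Type*} [MeasurableSpace Ω] (α : ℝ)
    (X : ℝ≥0 → Ω → MarkedPartition) (P : Kernel MarkedPartition Ω) [IsMarkovKernel P]
    (hX : IsESSF α X P)
    -- an arbitrary initial law; the choice of a Dirac mass gives the process under `P x`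
    (μ : Measure MarkedPartition) [IsProbabilityMeasure μ]
    (L : ℕ → Ω → ℝ≥0∞) (hL : IsStoppingLine X hX.measurable (μ.bind P) L) :
    -- all objects of the claim are measurable
    lineSigma X L ≤ (inferInstance : MeasurableSpace Ω) ∧
    Measurable (stoppedValueAt X L) ∧
    Measurable (fun ω (t : ℝ≥0) => stoppedValueAt X (fun i ω => L i ω + t) ω) ∧
    Measurable (fun p : Ω × (ℕ → Ω) =>
      ssfrag α (stoppedValueAt X L p.1) fun k t => X t (p.2 k)) ∧
    -- on the product space, where the processes `t ↦ X t (p.2 k)` are i.i.d. copies of the process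
    -- started from `(𝟏, 1)` and are independent of `p.1`
    ∀ C : Set (ℝ≥0 → MarkedPartition), MeasurableSet C →
      ((μ.bind P).prod (Measure.infinitePi fun _ : ℕ => P one))⟦
          {p : Ω × (ℕ → Ω) | (fun t : ℝ≥0 => stoppedValueAt X (fun i ω => L i ω + t) p.1) ∈ C} |
          (lineSigma X L).comap Prod.fst⟧
        =ᵐ[(μ.bind P).prod (Measure.infinitePi fun _ : ℕ => P one)]
      ((μ.bind P).prod (Measure.infinitePi fun _ : ℕ => P one))⟦
          {p : Ω × (ℕ → Ω) |
            (ssfrag α (stoppedValueAt X L p.1) fun k t => X t (p.2 k)) ∈ C} |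
          (lineSigma X L).comap Prod.fst⟧ := by
  have hm := hX.measurable
  have hc := hX.cadlag
  have hLm := hL.measurable
  have hσ : lineSigma X L ≤ (inferInstance : MeasurableSpace Ω) := iSup_le fun t =>
    (measurable_stoppedValueAt hm hc fun i => (hLm i).min measurable_const).comap_le
  have hR : Measurable (restartedPath X L) := measurable_restartedPath hm hc hLm
  have hB : Measurable (branchedPath α X L) := measurable_branchedPath hm hc α hLm
  refine ⟨hσ, measurable_stoppedValueAt hm hc hLm, hR, hB, fun C hC => ?_⟩
  set Q := Measure.infinitePi fun _ : ℕ => P one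
  have hle : (lineSigma X L).comap (Prod.fst : Ω × (ℕ → Ω) → Ω) ≤
      (inferInstance : MeasurableSpace (Ω × (ℕ → Ω))) :=
    (MeasurableSpace.comap_mono hσ).trans measurable_fst.comap_le
  have hE1 : MeasurableSet {p : Ω × (ℕ → Ω) | restartedPath X L p.1 ∈ C} :=
    (hR.comp measurable_fst) hC
  have hE2 : MeasurableSet {p : Ω × (ℕ → Ω) | branchedPath α X L p ∈ C} := hB hC
  -- By uniqueness of conditional expectation, it suffices that the two events have the same
  -- probability on each event of `lineSigma X L`.
  refine ae_eq_condExp_of_forall_setIntegral_eq hle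
    ((integrable_const (1 : ℝ)).indicator hE2) (fun s _ _ => integrable_condExp.integrableOn)
    (fun s hs _ => ?_) stronglyMeasurable_condExp.aestronglyMeasurable
  have hs' := hle s hs
  refine (setIntegral_condExp hle ((integrable_const (1 : ℝ)).indicator hE1) hs).trans ?_
  obtain ⟨A, hA, rfl⟩ := hs
  have h := hX.prob_stoppingLine μ hL hA hC
  have hprod : ((μ.bind P).prod Q) (Prod.fst ⁻¹' A ∩ {p | restartedPath X L p.1 ∈ C}) =
      (μ.bind P) (A ∩ {ω | restartedPath X L ω ∈ C}) := by
    have e : Prod.fst ⁻¹' A ∩ {p : Ω × (ℕ → Ω) | restartedPath X L p.1 ∈ C} =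
        (A ∩ {ω | restartedPath X L ω ∈ C}) ×ˢ univ := by
      ext p
      simp
    rw [e, Measure.prod_prod, measure_univ, mul_one]
  refine (setIntegral_indicator hE1).trans (Eq.trans ?_ (setIntegral_indicator hE2).symm)
  rw [setIntegral_const, setIntegral_const]
  exact congrArg (fun a => ENNReal.toReal a • (1 : ℝ)) (hprod.trans h)
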